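/- Let $N\ge 2$, let $F_N$ be the free group with basis $a_1,\dots,a_N$, and let $\partial F_N$ be its boundary. Let $\mathcal C_N$ be the space of closed subsets of $\partial F_N$ with at least two points, with the subspace topology of the Vietoris topology. Let $\mathcal S\mathrm{Curr}(F_N)$ be the set of subset currents on $F_N$, i.e. $F_N$-invariant Borel measures on $\mathcal C_N$ that are finite on compact sets, with its $\mathbb R_{\ge0}$-linear structure and the weak-$*$ topology (the coarsest one making $\mu\mapsto\int f\,d\mu$ continuous for all compactly supported continuous $f:\mathcal C_N\to\mathbb R$). For a nontrivial finitely generated subgroup $H\le F_N$ let $\widehat H$ be its commensurator in $F_N$ and let $$\eta_H=[\widehat H:H]\sum_{H'\in[\widehat H]}\delta_{\Lambda(H')}\in\mathcal S\mathrm{Curr}(F_N),$$ where $[\widehat H]$ is the conjugacy class of $\widehat H$ and $\Lambda(H')\subset\partial F_N$ is the limit set of $H'$; put $\eta_{\{1\}}=0$. **Proposition.** Suppose that an $\mathbb R_{\ge0}$-bilinear map $\pitchfork:\mathcal S\mathrm{Curr}(F_N)\times\mathcal S\mathrm{Curr}(F_N)\to\mathcal S\mathrm{Curr}(F_N)$ satisfies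 $$\pitchfork(\eta_H,\eta_K)=\sum_{HgK\in H\backslash F_N/K}\eta_{H\cap gKg^{-1}}$$ for all finitely generated subgroups $H,K\le F_N$. Then $\pitchfork$ is not continuous. (So no continuous $\mathbb R_{\ge0}$-bilinear map satisfies this condition, which answers a question of Kapovich and Nagnibeda negatively.) More precisely, $\frac1n\eta_{\langle a_1^na_2\rangle}\to\eta_{\langle a_1\rangle}$ in $\mathcal S\mathrm{Curr}(F_N)$ as $n\to\infty$, but $\pitchfork\bigl(\frac1n\eta_{\langle a_1^na_2\rangle},\eta_{\langle a_1\rangle}\bigr)$ does not converge to $\pitchfork(\eta_{\langle a_1\rangle},\eta_{\langle a_1\rangle})$. -/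

import Mathlib

open scoped NNReal

namespace SubsetCurrent

/-- The formal inverse of a letter; `(i, true)` stands for the basis element `a_i` and `(i, false)`
for its inverse, as in `FreeGroup`. -/
def letterInv {N : ℕ} (s : Fin N × Bool) : Fin N × Bool := (s.1, !s.2)

/-- The boundary of the free group `F_N = FreeGroup (Fin N)`, that is, the geodesic boundary of the
Cayley tree of `F_N` with respect to the basis: a boundary point is the infinite freely reduced word
read off along the geodesic ray from the identity to that point. -/
def Boundary (N : ℕ) : Type :=
  {w : ℕ → Fin N × Bool // ∀ i, w (i + 1) ≠ letterInv (w i)}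

/-- The topology of letterwise convergence; the cylinders form a basis of it. -/
instance (N : ℕ) : TopologicalSpace (Boundary N) :=
  inferInstanceAs (TopologicalSpace {w : ℕ → Fin N × Bool // ∀ i, w (i + 1) ≠ letterInv (w i)})

theorem letterInv_letterInv {N : ℕ} (s : Fin N × Bool) : letterInv (letterInv s) = s := by
  simp [letterInv]

/-- Left multiplication of an infinite reduced word by one letter, followed by free reduction. -/
def step {N : ℕ} (s : Fin N × Bool) (w : Boundary N) : Boundary N :=
  if h : w.1 0 = letterInv s then ⟨fun i => w.1 (i + 1), fun i => w.2 (i + 1)⟩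
  else ⟨fun i => Nat.casesOn i s w.1, fun i => by
    cases i with
    | zero => exact h
    | succ i => exact w.2 i⟩

theorem step_apply {N : ℕ} (s : Fin N × Bool) (w : Boundary N) (i : ℕ) :
    (step s w).1 i =
      if w.1 0 = letterInv s then w.1 (i + 1) else if i = 0 then s else w.1 (i - 1) := by
  unfold step
  split_ifs with h <;> simp_all
  cases i <;> simp_all

theorem step_letterInv_step {N : ℕ} (s : Fin N × Bool) (w : Boundary N) :
    step (letterInv s) (step s w) = w := by
  apply Subtype.ext
  funext i
  have h1 := w.2 0
  simp only [step_apply, letterInv_letterInv]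
  by_cases h : w.1 0 = letterInv s
  · rw [h, letterInv_letterInv] at h1
    have h1' : ¬ w.1 1 = s := by simpa using h1
    cases i <;> simp [h, h1']
  · simp [h]

theorem continuous_step {N : ℕ} (s : Fin N × Bool) : Continuous (step s) := by
  refine continuous_induced_rng.2 (continuous_pi fun i => ?_)
  have hc : ∀ j, Continuous (fun w : Boundary N => w.1 j) := fun j =>
    (continuous_apply j).comp continuous_subtype_val
  have hd : Continuous (fun p : (Fin N × Bool) × (Fin N × Bool) × (Fin N × Bool) =>
      if p.1 = letterInv s then p.2.1 else if i = 0 then s else p.2.2) :=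
    continuous_of_discreteTopology
  have := hd.comp ((hc 0).prodMk ((hc (i + 1)).prodMk (hc (i - 1))))
  refine this.congr fun w => ?_
  exact (step_apply s w i).symm

def stepHomeo {N : ℕ} (s : Fin N × Bool) : Boundary N ≃ₜ Boundary N where
  toFun := step s
  invFun := step (letterInv s)
  left_inv := step_letterInv_step s
  right_inv w := by
    have := step_letterInv_step (letterInv s) w
    rwa [letterInv_letterInv] at this
  continuous_toFun := continuous_step s
  continuous_invFun := continuous_step _

/-- The action of `F_N` on its boundary by homeomorphisms: left multiplication of infinite words
followed by free reduction. -/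
def boundaryAction (N : ℕ) : FreeGroup (Fin N) →* (Boundary N ≃ₜ Boundary N) :=
  FreeGroup.lift fun i => stepHomeo (i, true)

theorem boundaryAction_mk_singleton {N : ℕ} (s : Fin N × Bool) (w : Boundary N) :
    boundaryAction N (FreeGroup.mk [s]) w = step s w := by
  obtain ⟨i, b⟩ := s
  cases b
  · have : (FreeGroup.mk [(i, false)] : FreeGroup (Fin N)) = (FreeGroup.of i)⁻¹ := rfl
    rw [this, map_inv, boundaryAction, FreeGroup.lift_apply_of]
    rfl
  · have : (FreeGroup.mk [(i, true)] : FreeGroup (Fin N)) = FreeGroup.of i := rfl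
    rw [this, boundaryAction, FreeGroup.lift_apply_of]
    rfl

/-- `ConvergesTo h ξ`: the sequence `h` of vertices of the Cayley tree converges to the boundary
point `ξ`, that is, for each `i` the `i`-th letter of the reduced word `h n` is eventually
that of `ξ`. -/
def ConvergesTo {N : ℕ} (h : ℕ → FreeGroup (Fin N)) (ξ : Boundary N) : Prop :=
  ∀ i, ∀ᶠ n in Filter.atTop, (h n).toWord[i]? = some (ξ.1 i)

/-- The limit set of a subgroup in the boundary. -/
def limitSet {N : ℕ} (H : Subgroup (FreeGroup (Fin N))) : Set (Boundary N) :=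
  {ξ | ∃ h : ℕ → FreeGroup (Fin N), (∀ n, h n ∈ H) ∧ ConvergesTo h ξ}

/-- The first `k` letters of the reduced word of `g` are those of `ξ`. -/
def Agree {N : ℕ} (k : ℕ) (g : FreeGroup (Fin N)) (ξ : Boundary N) : Prop :=
  ∀ i < k, g.toWord[i]? = some (ξ.1 i)

theorem Agree.mono {N : ℕ} {k l : ℕ} {g : FreeGroup (Fin N)} {ξ : Boundary N}
    (h : Agree l g ξ) (hkl : k ≤ l) : Agree k g ξ := fun i hi => h i (hi.trans_le hkl)

theorem mem_limitSet_iff {N : ℕ} {H : Subgroup (FreeGroup (Fin N))} {ξ : Boundary N} :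
    ξ ∈ limitSet H ↔ ∀ k, ∃ h ∈ H, Agree k h ξ := by
  constructor
  · rintro ⟨h, hH, hc⟩ k
    have : ∀ᶠ n in Filter.atTop, ∀ i ∈ Finset.range k, (h n).toWord[i]? = some (ξ.1 i) :=
      (Filter.eventually_all_finset _).2 fun i _ => hc i
    obtain ⟨n, hn⟩ := this.exists
    exact ⟨h n, hH n, fun i hi => hn i (Finset.mem_range.2 hi)⟩
  · intro h
    choose f hf hf' using h
    refine ⟨f, hf, fun i => ?_⟩
    filter_upwards [Filter.eventually_gt_atTop i] with n hn using hf' n i hn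

/-- The boundary points that share the first `k` letters with `ξ`. -/
def cyl {N : ℕ} (k : ℕ) (ξ : Boundary N) : Set (Boundary N) := {η | ∀ i < k, η.1 i = ξ.1 i}

theorem isOpen_cyl {N : ℕ} (k : ℕ) (ξ : Boundary N) : IsOpen (cyl k ξ) := by
  have : cyl k ξ = ⋂ i ∈ Finset.range k, (fun η : Boundary N => η.1 i) ⁻¹' {ξ.1 i} := by
    ext η; simp [cyl]
  rw [this]
  exact isOpen_biInter_finset fun i _ => (isOpen_discrete _).preimage
    ((continuous_apply i).comp continuous_subtype_val)

theorem mem_cyl_self {N : ℕ} (k : ℕ) (ξ : Boundary N) : ξ ∈ cyl k ξ := fun _ _ => rfl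

theorem isClosed_limitSet {N : ℕ} (H : Subgroup (FreeGroup (Fin N))) : IsClosed (limitSet H) := by
  refine isClosed_of_closure_subset fun ξ hξ => mem_limitSet_iff.2 fun k => ?_
  obtain ⟨η, hη, hη'⟩ := mem_closure_iff.1 hξ _ (isOpen_cyl k ξ) (mem_cyl_self k ξ)
  obtain ⟨h, hH, ha⟩ := mem_limitSet_iff.1 hη' k
  exact ⟨h, hH, fun i hi => by rw [ha i hi, hη i hi]⟩

theorem agree_step {N : ℕ} {k : ℕ} {s : Fin N × Bool} {h : FreeGroup (Fin N)} {ξ : Boundary N}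
    (ha : Agree (k + 1) h ξ) : Agree k (FreeGroup.mk [s] * h) (step s ξ) := by
  intro i hi
  have hw : (FreeGroup.mk [s] * h).toWord = FreeGroup.reduce (s :: h.toWord) := by
    rw [FreeGroup.toWord_mul, FreeGroup.toWord_mk, FreeGroup.reduce_singleton]; rfl
  rw [hw, FreeGroup.reduce.cons, FreeGroup.reduce_toWord, step_apply]
  have h0 := ha 0 (by omega)
  have h1 := ha (i + 1) (by omega)
  have h2 := ha (i - 1) (by omega)
  rcases hL : h.toWord with _ | ⟨x, t⟩
  · simp [hL] at h0
  · rw [hL] at h0 h1 h2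
    have hx : x = ξ.1 0 := by simpa using h0
    have hiff : (s.1 = x.1 ∧ s.2 = !x.2) ↔ ξ.1 0 = letterInv s := by
      rw [← hx, letterInv, Prod.ext_iff]
      constructor
      · rintro ⟨h, h'⟩; simp [h, h']
      · rintro ⟨h, h'⟩; simp at h h'; simp [h, h']
    by_cases hc : ξ.1 0 = letterInv s
    · simp only [hiff, hc, if_true]; simpa using h1
    · simp only [hiff, hc, if_false]
      cases i with
      | zero => simp
      | succ i => simpa using h2

theorem agree_mul {N : ℕ} (g : FreeGroup (Fin N)) : ∃ m, ∀ k h ξ, Agree (k + m) h ξ →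
    Agree k (g * h) (boundaryAction N g ξ) := by
  obtain ⟨L, rfl⟩ : ∃ L, FreeGroup.mk L = g := ⟨g.toWord, FreeGroup.mk_toWord⟩
  induction L with
  | nil =>
    refine ⟨0, fun k h ξ ha => ?_⟩
    have : (FreeGroup.mk [] : FreeGroup (Fin N)) = 1 := rfl
    rw [this, map_one, one_mul]; exact ha
  | cons s L ih =>
    obtain ⟨m, hm⟩ := ih
    refine ⟨m + 1, fun k h ξ ha => ?_⟩
    have : (FreeGroup.mk (s :: L) : FreeGroup (Fin N)) = FreeGroup.mk [s] * FreeGroup.mk L := rfl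
    rw [this, map_mul, mul_assoc, Homeomorph.mul_apply, boundaryAction_mk_singleton]
    exact agree_step (hm (k + 1) h ξ (ha.mono (by omega)))

theorem toWord_mul_letter {N : ℕ} (x : FreeGroup (Fin N)) (s : Fin N × Bool) :
    x.toWord.length ≤ (x * FreeGroup.mk [s]).toWord.length + 1 ∧
    ∀ i, i + 1 < x.toWord.length → (x * FreeGroup.mk [s]).toWord[i]? = x.toWord[i]? := by
  rcases List.eq_nil_or_concat x.toWord with h | ⟨l, b, h⟩
  · simp [h]
  · rw [List.concat_eq_append] at h
    have hred : FreeGroup.IsReduced (l ++ [b]) := h ▸ FreeGroup.isReduced_toWord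
    have hx : x = FreeGroup.mk (l ++ [b]) := by rw [← h, FreeGroup.mk_toWord]
    by_cases hb : b.1 = s.1 ∧ b.2 = !s.2
    · have : x * FreeGroup.mk [s] = FreeGroup.mk l := by
        rw [hx, FreeGroup.mul_mk]
        apply Quot.sound
        have := FreeGroup.Red.Step.not (L₁ := l) (L₂ := []) (x := b.1) (b := b.2)
        have hs : s = (b.1, !b.2) := by ext <;> simp [hb.1, hb.2]
        rw [hs]; simpa using this
      have hl : (FreeGroup.mk l).toWord = l := by
        rw [FreeGroup.toWord_mk]; exact (hred.infix ⟨[], [b], by simp⟩).reduce_eq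
      rw [this, hl, h]
      refine ⟨by simp, fun i hi => ?_⟩
      rw [List.getElem?_append_left (by simpa using hi)]
    · have h2 : FreeGroup.IsReduced ([b] ++ [s]) := by
        rw [List.singleton_append, FreeGroup.isReduced_cons_cons]
        refine ⟨fun h1 => ?_, FreeGroup.IsReduced.singleton⟩
        by_contra h2
        exact hb ⟨h1, by cases hbb : b.2 <;> cases hss : s.2 <;> simp_all⟩
      have h3 := FreeGroup.IsReduced.append_overlap hred h2 (by simp)
      have : (x * FreeGroup.mk [s]).toWord = l ++ [b] ++ [s] := by
        rw [hx, FreeGroup.mul_mk, FreeGroup.toWord_mk, h3.reduce_eq]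
      rw [this, h]
      refine ⟨by simp, fun i hi => ?_⟩
      rw [List.getElem?_append_left (by omega)]

theorem toWord_mul_right {N : ℕ} (c x : FreeGroup (Fin N)) (i : ℕ)
    (hi : i + c.norm < x.norm) : (x * c).toWord[i]? = x.toWord[i]? := by
  suffices ∀ (L : List (Fin N × Bool)) (x : FreeGroup (Fin N)), i + L.length < x.norm →
      (x * FreeGroup.mk L).toWord[i]? = x.toWord[i]? by
    have := this c.toWord x hi
    rwa [FreeGroup.mk_toWord] at this
  intro L
  induction L with
  | nil =>
    intro x _
    have : (FreeGroup.mk [] : FreeGroup (Fin N)) = 1 := rfl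
    rw [this, mul_one]
  | cons s L ih =>
    intro x hx
    have h := toWord_mul_letter x s
    have : (FreeGroup.mk (s :: L) : FreeGroup (Fin N)) = FreeGroup.mk [s] * FreeGroup.mk L := rfl
    simp only [FreeGroup.norm, List.length_cons] at hx ih
    rw [this, ← mul_assoc, ih _ (by omega), h.2 i (by omega)]

theorem Agree.le_norm {N : ℕ} {k : ℕ} {g : FreeGroup (Fin N)} {ξ : Boundary N} (h : Agree k g ξ) :
    k ≤ g.norm := by
  by_contra hlt
  have := h g.norm (by omega)
  simp [FreeGroup.norm] at this

theorem agree_mul_right {N : ℕ} {k : ℕ} {g c : FreeGroup (Fin N)} {ξ : Boundary N}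
    (h : Agree (k + c.norm) g ξ) : Agree k (g * c) ξ := fun i hi => by
  have := h.le_norm
  rw [toWord_mul_right c g i (by omega), h i (by omega)]

theorem agree_of_mul_right {N : ℕ} {k : ℕ} {g c : FreeGroup (Fin N)} {ξ : Boundary N}
    (h : Agree (k + c.norm) (g * c) ξ) : Agree k g ξ := by
  have := agree_mul_right (c := c⁻¹) (g := g * c) (k := k) (ξ := ξ)
    (by rwa [FreeGroup.norm_inv_eq])
  rwa [mul_inv_cancel_right] at this

/-- The conjugate subgroup `g H g⁻¹`. -/
def conjBy {N : ℕ} (g : FreeGroup (Fin N)) (H : Subgroup (FreeGroup (Fin N))) :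
    Subgroup (FreeGroup (Fin N)) :=
  H.map (MulAut.conj g).toMonoidHom

theorem mem_conjBy {N : ℕ} {g x : FreeGroup (Fin N)} {H : Subgroup (FreeGroup (Fin N))} :
    x ∈ conjBy g H ↔ g⁻¹ * x * g ∈ H := by
  simp only [conjBy, Subgroup.mem_map]
  constructor
  · rintro ⟨h, hH, rfl⟩; simpa [mul_assoc] using hH
  · intro h; exact ⟨_, h, by simp [mul_assoc]⟩

theorem conjBy_mul {N : ℕ} (g g' : FreeGroup (Fin N)) (H : Subgroup (FreeGroup (Fin N))) :
    conjBy (g * g') H = conjBy g (conjBy g' H) := by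
  ext x; simp [mem_conjBy, mul_assoc]

theorem conjBy_one {N : ℕ} (H : Subgroup (FreeGroup (Fin N))) : conjBy 1 H = H := by
  ext x; simp [mem_conjBy]

theorem conjBy_ne_bot {N : ℕ} {g : FreeGroup (Fin N)} {H : Subgroup (FreeGroup (Fin N))}
    (hH : H ≠ ⊥) : conjBy g H ≠ ⊥ := by
  intro h
  apply hH
  rw [← conjBy_one H, ← inv_mul_cancel g, conjBy_mul, h]
  simp [conjBy]

open scoped Pointwise in
theorem toConjAct_smul {N : ℕ} (g : FreeGroup (Fin N)) (H : Subgroup (FreeGroup (Fin N))) :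
    ConjAct.toConjAct g • H = conjBy g H := by
  ext x
  rw [mem_conjBy, Subgroup.mem_pointwise_smul_iff_inv_smul_mem, ← map_inv, ConjAct.smul_def]
  simp

theorem limitSet_mono {N : ℕ} {H K : Subgroup (FreeGroup (Fin N))} (h : H ≤ K) :
    limitSet H ⊆ limitSet K := fun _ ⟨f, hf, hc⟩ => ⟨f, fun n => h (hf n), hc⟩

theorem image_limitSet_subset {N : ℕ} (g : FreeGroup (Fin N)) (H : Subgroup (FreeGroup (Fin N))) :
    boundaryAction N g '' limitSet H ⊆ limitSet (conjBy g H) := by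
  rintro _ ⟨ξ, hξ, rfl⟩
  refine mem_limitSet_iff.2 fun k => ?_
  obtain ⟨m, hm⟩ := agree_mul g
  obtain ⟨h, hH, ha⟩ := mem_limitSet_iff.1 hξ (k + g⁻¹.norm + m)
  exact ⟨g * h * g⁻¹, mem_conjBy.2 (by simpa [mul_assoc] using hH), agree_mul_right (hm _ _ _ ha)⟩

theorem image_limitSet {N : ℕ} (g : FreeGroup (Fin N)) (H : Subgroup (FreeGroup (Fin N))) :
    boundaryAction N g '' limitSet H = limitSet (conjBy g H) := by
  refine (image_limitSet_subset g H).antisymm fun ξ hξ => ?_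
  refine ⟨boundaryAction N g⁻¹ ξ, ?_, ?_⟩
  · have := image_limitSet_subset g⁻¹ (conjBy g H) (Set.mem_image_of_mem _ hξ)
    rwa [← conjBy_mul, inv_mul_cancel, conjBy_one] at this
  · rw [← Homeomorph.mul_apply, ← map_mul, mul_inv_cancel, map_one, Homeomorph.one_apply]

theorem limitSet_subset_of_relIndex {N : ℕ} {H L : Subgroup (FreeGroup (Fin N))}
    (h : H.relIndex L ≠ 0) : limitSet L ⊆ limitSet H := by
  intro ξ hξ
  have hfin : Finite (L ⧸ H.subgroupOf L) :=
    Subgroup.finiteIndex_iff_finite_quotient.1 (Subgroup.finiteIndex_iff.2 h)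
  obtain ⟨M, hM⟩ := (Set.finite_range fun q : L ⧸ H.subgroupOf L => ((q.out : L) : FreeGroup (Fin N)).norm).bddAbove
  refine mem_limitSet_iff.2 fun k => ?_
  obtain ⟨l, hl, ha⟩ := mem_limitSet_iff.1 hξ (k + M)
  set q : L ⧸ H.subgroupOf L := QuotientGroup.mk ⟨l⁻¹, inv_mem hl⟩ with hq
  have hmem : (q.out)⁻¹ * (⟨l⁻¹, inv_mem hl⟩ : L) ∈ H.subgroupOf L :=
    QuotientGroup.eq.1 (by rw [QuotientGroup.out_eq'])
  refine ⟨l * ((q.out : L) : FreeGroup (Fin N)), ?_, agree_mul_right (ha.mono ?_)⟩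
  · have := inv_mem (Subgroup.mem_subgroupOf.1 hmem)
    simpa using this
  · exact Nat.add_le_add_left (hM ⟨q, rfl⟩) k

theorem exists_limit_point {N : ℕ} (u c : List (Fin N × Bool)) (hc : c ≠ [])
    (hred : ∀ n, FreeGroup.IsReduced (u ++ (List.replicate (n + 1) c).flatten)) :
    ∃ ξ : Boundary N, (∀ k, ∃ n, ∀ i < k,
      (u ++ (List.replicate (n + 1) c).flatten)[i]? = some (ξ.1 i)) ∧
      ξ.1 u.length = c.head hc := by
  set W : ℕ → List (Fin N × Bool) := fun n => u ++ (List.replicate (n + 1) c).flatten with hW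
  have hlen : ∀ n, n < (W n).length := fun n => by
    have : 0 < c.length := List.length_pos_iff.2 hc
    simp only [hW, List.length_append, List.length_flatten, List.map_replicate, List.sum_replicate,
      smul_eq_mul]
    nlinarith
  have hsucc : ∀ n, W n <+: W (n + 1) := fun n => ⟨c, by
    simp [hW, List.replicate_succ' (n := n + 1), List.append_assoc]⟩
  have hpre : ∀ m n, m ≤ n → W m <+: W n := fun m n hmn => by
    induction hmn with
    | refl => exact List.prefix_rfl
    | step _ ih => exact ih.trans (hsucc _)
  have hget : ∀ m n i, i < (W m).length → m ≤ n → (W n)[i]? = (W m)[i]? := fun m n i hi hmn => by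
    obtain ⟨t, ht⟩ := hpre m n hmn
    rw [← ht, List.getElem?_append_left hi]
  have hval : ∀ n i, i ≤ n → (W n)[i]? = some ((W i)[i]'(hlen i)) := fun n i hin => by
    rw [hget i n i (hlen i) hin, List.getElem?_eq_getElem (hlen i)]
  refine ⟨⟨fun i => (W i)[i]'(hlen i), fun i heq => ?_⟩, fun k => ⟨k, fun i hi => ?_⟩, ?_⟩
  · have h0 := hval (i + 1) i (by omega)
    have h1 := hval (i + 1) (i + 1) le_rfl
    simp only at heq
    rw [heq] at h1
    have hr : FreeGroup.IsReduced (W (i + 1)) := hred (i + 1)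
    rw [FreeGroup.IsReduced, List.isChain_iff_getElem] at hr
    have hl := hlen (i + 1)
    have := hr i (by omega)
    rw [List.getElem?_eq_getElem (by omega), Option.some_inj] at h0
    rw [List.getElem?_eq_getElem hl, Option.some_inj] at h1
    rw [h0, h1] at this
    simp [letterInv] at this
  · exact hval k i hi.le
  · have hlt : u.length < (W 0).length := by
      simp [hW, List.length_pos_iff.2 hc]
    show (W u.length)[u.length]'(hlen _) = _
    have := hget 0 u.length u.length hlt (Nat.zero_le _)
    rw [List.getElem?_eq_getElem (hlen _)] at this
    have h2 : (W 0)[u.length]? = some (c.head hc) := by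
      simp [hW, List.getElem?_append_right, ← List.head?_eq_getElem?, List.head?_eq_some_head hc]
    rw [h2, Option.some_inj] at this
    exact this

theorem invRev_flatten_replicate {α : Type*} (c : List (α × Bool)) (n : ℕ) :
    FreeGroup.invRev (List.replicate n c).flatten
      = (List.replicate n (FreeGroup.invRev c)).flatten := by
  induction n with
  | zero => rfl
  | succ n ih =>
    rw [List.replicate_succ, List.flatten_cons, FreeGroup.invRev_append, ih,
      List.replicate_succ', List.flatten_concat]

theorem limitSet_nontrivial {N : ℕ} {H : Subgroup (FreeGroup (Fin N))} (hH : H ≠ ⊥) :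
    (limitSet H).Nontrivial := by
  obtain ⟨⟨h, hh⟩, h1⟩ := Subgroup.ne_bot_iff_exists_ne_one.1 hH
  replace h1 : h ≠ 1 := fun h => h1 (Subtype.ext h)
  set u := FreeGroup.reduceCyclically.conjugator h.toWord with hu
  set c := FreeGroup.reduceCyclically h.toWord with hcdef
  have hw : u ++ c ++ FreeGroup.invRev u = h.toWord :=
    FreeGroup.reduceCyclically.conj_conjugator_reduceCyclically _
  have hcyc : FreeGroup.IsCyclicallyReduced c :=
    FreeGroup.reduceCyclically.isCyclicallyReduced FreeGroup.isReduced_toWord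
  have hc : c ≠ [] := by
    intro hc
    rw [hc, List.append_nil] at hw
    apply h1
    rw [← FreeGroup.mk_toWord (x := h), ← hw, ← FreeGroup.mul_mk, ← FreeGroup.inv_mk,
      mul_inv_cancel]
  have hc' : FreeGroup.invRev c ≠ [] := by
    intro h0; apply hc; simpa [FreeGroup.invRev] using h0
  have hpow : ∀ n : ℕ, (h ^ (n + 1)).toWord
      = u ++ (List.replicate (n + 1) c).flatten ++ FreeGroup.invRev u := fun n => by
    rw [FreeGroup.toWord_pow]
    exact FreeGroup.reduceCyclically.reduce_flatten_replicate_succ FreeGroup.isReduced_toWord n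
  have hpow' : ∀ n : ℕ, (h ^ (n + 1))⁻¹.toWord
      = u ++ (List.replicate (n + 1) (FreeGroup.invRev c)).flatten ++ FreeGroup.invRev u :=
    fun n => by
      rw [FreeGroup.toWord_inv, hpow, FreeGroup.invRev_append, FreeGroup.invRev_append,
        FreeGroup.invRev_invRev, invRev_flatten_replicate, List.append_assoc]
  obtain ⟨ξ, hξ, hξ0⟩ := exists_limit_point u c hc fun n =>
    (FreeGroup.isReduced_toWord (x := h ^ (n + 1))).infix ⟨[], FreeGroup.invRev u, by simp [hpow]⟩
  obtain ⟨η, hη, hη0⟩ := exists_limit_point u _ hc' fun n =>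
    (FreeGroup.isReduced_toWord (x := (h ^ (n + 1))⁻¹)).infix
      ⟨[], FreeGroup.invRev u, by rw [hpow']; simp⟩
  have hpre : ∀ (a b : List (Fin N × Bool)) (i : ℕ) (x : Fin N × Bool), a[i]? = some x →
      (a ++ b)[i]? = some x := fun a b i x hx => by
    rw [List.getElem?_append_left (List.getElem?_eq_some_iff.1 hx).1, hx]
  refine ⟨ξ, ?_, η, ?_, ?_⟩
  · refine mem_limitSet_iff.2 fun k => ?_
    obtain ⟨n, hn⟩ := hξ k
    exact ⟨h ^ (n + 1), pow_mem hh _, fun i hi => by rw [hpow]; exact hpre _ _ _ _ (hn i hi)⟩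
  · refine mem_limitSet_iff.2 fun k => ?_
    obtain ⟨n, hn⟩ := hη k
    exact ⟨(h ^ (n + 1))⁻¹, inv_mem (pow_mem hh _), fun i hi => by
      rw [hpow']; exact hpre _ _ _ _ (hn i hi)⟩
  · intro heq
    rw [heq, hη0] at hξ0
    have hlast : (FreeGroup.invRev c).head hc' = letterInv (c.getLast hc) := by
      simp [FreeGroup.invRev, letterInv, List.head_reverse, List.getLast_map]
    rw [hlast] at hξ0
    have := hcyc.2 _ (List.getLast?_eq_some_getLast hc) _ (List.head?_eq_some_head hc)
    rw [← hξ0] at this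
    simp [letterInv] at this

/-- The commensurator of `H` moves the limit set of `H` into itself. -/
theorem image_limitSet_subset_of_mem {N : ℕ} {H : Subgroup (FreeGroup (Fin N))}
    {g : FreeGroup (Fin N)} (hg : g ∈ Subgroup.Commensurable.commensurator H) :
    boundaryAction N g '' limitSet H ⊆ limitSet H := by
  rw [image_limitSet]
  have := (Subgroup.Commensurable.commensurator_mem_iff H g).1 hg
  rw [toConjAct_smul] at this
  exact limitSet_subset_of_relIndex this.2

theorem le_commensurator {N : ℕ} (H : Subgroup (FreeGroup (Fin N))) :
    H ≤ Subgroup.Commensurable.commensurator H := fun g hg => by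
  rw [Subgroup.Commensurable.commensurator_mem_iff, toConjAct_smul]
  have : conjBy g H = H := by
    ext x
    rw [mem_conjBy, Subgroup.mul_mem_cancel_right _ hg,
      Subgroup.mul_mem_cancel_left _ (inv_mem hg)]
  rw [this]

/-- For finitely generated `H`, the cosets `g H` for which `g Λ(H)` meets two given disjoint
cylinders have representatives of bounded word length. -/
theorem exists_bound {N : ℕ} {H : Subgroup (FreeGroup (Fin N))} (hH : H.FG) (k : ℕ)
    (ξ η : Boundary N) (hne : ∃ i < k, ξ.1 i ≠ η.1 i) :
    ∃ R : ℕ, ∀ g : FreeGroup (Fin N), (boundaryAction N g '' limitSet H ∩ cyl k ξ).Nonempty →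
      (boundaryAction N g '' limitSet H ∩ cyl k η).Nonempty → ∃ h ∈ H, (g * h).norm < R := by
  obtain ⟨T, hT⟩ := hH
  obtain ⟨M, hM⟩ := (T.finite_toSet.image FreeGroup.norm).bddAbove
  refine ⟨k + M, fun g hξ hη => ?_⟩
  obtain ⟨m, hm⟩ := agree_mul g
  have key : ∀ ζ : Boundary N, (boundaryAction N g '' limitSet H ∩ cyl k ζ).Nonempty →
      ∃ h ∈ H, Agree k (g * h) ζ := by
    rintro ζ ⟨_, ⟨x, hx, rfl⟩, hz⟩
    obtain ⟨h, hh, ha⟩ := mem_limitSet_iff.1 hx (k + m)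
    exact ⟨h, hh, fun i hi => by rw [hm k h x ha i hi, hz i hi]⟩
  obtain ⟨h, hh, ha⟩ := key ξ hξ
  obtain ⟨h', hh', ha'⟩ := key η hη
  by_contra! hcon
  have hconst : ∀ y ∈ H, ∀ x ∈ H, ∀ i < k, (g * x * y).toWord[i]? = (g * x).toWord[i]? := by
    intro y hy
    rw [← hT] at hy
    induction hy using Subgroup.closure_induction with
    | mem t ht =>
      intro x hx i hi
      have h1 : t.norm ≤ M := hM ⟨t, ht, rfl⟩
      have h2 := hcon x hx
      exact toWord_mul_right _ _ _ (by omega)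
    | one => intro x hx i hi; rw [mul_one]
    | mul a b ha' hb' iha ihb =>
      intro x hx i hi
      rw [hT] at ha'
      have := ihb (x * a) (mul_mem hx ha') i hi
      rw [← mul_assoc] at this
      rw [← mul_assoc, this, iha x hx i hi]
    | inv a ha' iha =>
      intro x hx i hi
      rw [hT] at ha'
      have := iha (x * a⁻¹) (mul_mem hx (inv_mem ha')) i hi
      rw [← mul_assoc, inv_mul_cancel_right] at this
      exact this.symm
  obtain ⟨i, hi, hne⟩ := hne
  have h1 := hconst h hh 1 (one_mem H) i hi
  have h2 := hconst h' hh' 1 (one_mem H) i hi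
  rw [mul_one] at h1 h2
  rw [ha i hi] at h1
  rw [ha' i hi, ← h1, Option.some_inj] at h2
  exact hne h2.symm

theorem limitSet_commensurator {N : ℕ} {H : Subgroup (FreeGroup (Fin N))} (hH : H.FG)
    (h1 : H ≠ ⊥) : limitSet (Subgroup.Commensurable.commensurator H) = limitSet H := by
  refine Set.Subset.antisymm (fun ζ hζ => ?_) (limitSet_mono (le_commensurator H))
  obtain ⟨ξ, hξ, η, hη, hne⟩ := limitSet_nontrivial h1
  obtain ⟨i, hi⟩ : ∃ i, ξ.1 i ≠ η.1 i := by
    by_contra! hcon; exact hne (Subtype.ext (funext hcon))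
  obtain ⟨R, hR⟩ := exists_bound hH (i + 1) ξ η ⟨i, by omega, hi⟩
  refine mem_limitSet_iff.2 fun k => ?_
  obtain ⟨g, hg, ha⟩ := mem_limitSet_iff.1 hζ (k + R)
  have hmeet : ∀ x ∈ limitSet H, (boundaryAction N g⁻¹ '' limitSet H ∩ cyl (i + 1) x).Nonempty :=
    fun x hx => ⟨x, ⟨boundaryAction N g x,
      image_limitSet_subset_of_mem hg (Set.mem_image_of_mem _ hx), by
        rw [← Homeomorph.mul_apply, ← map_mul, inv_mul_cancel, map_one, Homeomorph.one_apply]⟩,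
      mem_cyl_self _ _⟩
  obtain ⟨h, hh, hn⟩ := hR g⁻¹ (hmeet ξ hξ) (hmeet η hη)
  refine ⟨h⁻¹⁻¹, inv_mem (inv_mem hh), ?_⟩
  have : Agree k (g * (g⁻¹ * h)) ζ := agree_mul_right (ha.mono (by omega))
  simpa using this

/-- The space of all closed subsets of the boundary consisting of at least two points. -/
def SubsetSpace (N : ℕ) : Type := {S : Set (Boundary N) // IsClosed S ∧ S.Nontrivial}

/-- The subspace topology of the Vietoris topology. -/
instance (N : ℕ) : TopologicalSpace (SubsetSpace N) :=
  .induced Subtype.val (TopologicalSpace.vietoris (Boundary N))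

instance (N : ℕ) : MeasurableSpace (SubsetSpace N) := borel _

instance (N : ℕ) : BorelSpace (SubsetSpace N) := ⟨rfl⟩

/-- The action of `F_N` on closed subsets of the boundary. -/
def translate {N : ℕ} (g : FreeGroup (Fin N)) (S : SubsetSpace N) : SubsetSpace N :=
  ⟨boundaryAction N g '' S.1, (boundaryAction N g).isClosedMap _ S.2.1,
    S.2.2.image (boundaryAction N g).injective⟩

theorem continuous_translate {N : ℕ} (g : FreeGroup (Fin N)) :
    Continuous (translate g : SubsetSpace N → SubsetSpace N) := by
  let _ := TopologicalSpace.vietoris (Boundary N)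
  exact continuous_induced_rng.2
    ((boundaryAction N g).continuous.image_vietoris.comp continuous_induced_dom)

/-- The limit set of a nontrivial subgroup, as a point of the space of closed subsets. -/
def limitPoint {N : ℕ} (H : Subgroup (FreeGroup (Fin N))) (hH : H ≠ ⊥) : SubsetSpace N :=
  ⟨limitSet H, isClosed_limitSet H, limitSet_nontrivial hH⟩

/-- The convex cone of subset currents on `F_N`: Borel measures on the space of closed subsets of
the boundary with at least two points that are `F_N`-invariant and finite on compact sets. -/
def SCurr (N : ℕ) : Submodule ℝ≥0 (MeasureTheory.Measure (SubsetSpace N)) where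
  carrier := {μ | (∀ (g : FreeGroup (Fin N)) (U : Set (SubsetSpace N)), MeasurableSet U →
      μ (translate g ⁻¹' U) = μ U) ∧ ∀ K : Set (SubsetSpace N), IsCompact K → μ K < ⊤}
  zero_mem' := by simp
  add_mem' := by
    rintro μ ν ⟨h1, h2⟩ ⟨h3, h4⟩
    refine ⟨fun g U hU => ?_, fun K hK => ?_⟩
    · simp [h1 g U hU, h3 g U hU]
    · simpa using ⟨h2 K hK, h4 K hK⟩
  smul_mem' := by
    rintro c μ ⟨h1, h2⟩
    refine ⟨fun g U hU => ?_, fun K hK => ?_⟩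
    · simp [h1 g U hU]
    · rw [MeasureTheory.Measure.smul_apply]
      exact ENNReal.mul_lt_top ENNReal.coe_lt_top (h2 K hK)

open scoped CompactlySupported in
/-- The weak-* topology: the coarsest topology for which `μ ↦ ∫ f dμ` is continuous for every
continuous compactly supported function `f`. -/
noncomputable instance (N : ℕ) : TopologicalSpace (SCurr N) :=
  ⨅ f : C_c(SubsetSpace N, ℝ), .induced
    (fun μ : SCurr N => ∫ S, f S ∂(μ : MeasureTheory.Measure (SubsetSpace N))) inferInstance

/-- The type of conjugates of a subgroup (each conjugate occurs once). -/
def ConjClass {N : ℕ} (H : Subgroup (FreeGroup (Fin N))) : Type :=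
  {H' : Subgroup (FreeGroup (Fin N)) // ∃ g, H' = conjBy g H}

theorem ConjClass.ne_bot {N : ℕ} {H : Subgroup (FreeGroup (Fin N))} (hH : H ≠ ⊥)
    (H' : ConjClass (Subgroup.Commensurable.commensurator H)) : H'.1 ≠ ⊥ := by
  obtain ⟨g, hg⟩ := H'.2
  rw [hg]
  exact conjBy_ne_bot fun h => hH (le_bot_iff.1 (h ▸ le_commensurator H))

open Classical in
/-- The counting measure of a subgroup `H`: it is zero if `H` is trivial and
`[Ĥ : H] ∑_{H' ∈ [Ĥ]} δ_{Λ(H')}` otherwise, where `Ĥ` is the commensurator of `H` and `[Ĥ]` its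
conjugacy class. (`H.relIndex Ĥ` is the index of `H` in `Ĥ`; it is finite for finitely
generated `H ≠ 1`.) -/
noncomputable def countingMeasure {N : ℕ} (H : Subgroup (FreeGroup (Fin N))) :
    MeasureTheory.Measure (SubsetSpace N) :=
  if hH : H = ⊥ then 0
  else H.relIndex (Subgroup.Commensurable.commensurator H) •
    MeasureTheory.Measure.sum
      fun H' : ConjClass (Subgroup.Commensurable.commensurator H) =>
        MeasureTheory.Measure.dirac (limitPoint H'.1 (ConjClass.ne_bot hH H'))

/-- Conjugation as a permutation of a conjugacy class of subgroups. -/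
def ConjClass.conj {N : ℕ} {H : Subgroup (FreeGroup (Fin N))} (g : FreeGroup (Fin N)) :
    ConjClass H ≃ ConjClass H where
  toFun H' := ⟨conjBy g H'.1, by
    obtain ⟨g', hg'⟩ := H'.2; exact ⟨g * g', by rw [hg', conjBy_mul]⟩⟩
  invFun H' := ⟨conjBy g⁻¹ H'.1, by
    obtain ⟨g', hg'⟩ := H'.2; exact ⟨g⁻¹ * g', by rw [hg', conjBy_mul]⟩⟩
  left_inv H' := Subtype.ext (by
    show conjBy g⁻¹ (conjBy g H'.1) = _
    rw [← conjBy_mul, inv_mul_cancel, conjBy_one])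
  right_inv H' := Subtype.ext (by
    show conjBy g (conjBy g⁻¹ H'.1) = _
    rw [← conjBy_mul, mul_inv_cancel, conjBy_one])

theorem finite_norm_lt {N : ℕ} (R : ℕ) : {g : FreeGroup (Fin N) | g.norm < R}.Finite :=
  (List.finite_length_lt (Fin N × Bool) R).preimage FreeGroup.toWord_injective.injOn

/-- The counting measure of a finitely generated subgroup is a subset current. -/
theorem countingMeasure_mem {N : ℕ} {H : Subgroup (FreeGroup (Fin N))} (hH : H.FG) :
    countingMeasure H ∈ SCurr N := by
  unfold countingMeasure
  split_ifs with h1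
  · exact zero_mem _
  suffices key : MeasureTheory.Measure.sum
      (fun H' : ConjClass (Subgroup.Commensurable.commensurator H) =>
        MeasureTheory.Measure.dirac (limitPoint H'.1 (ConjClass.ne_bot h1 H'))) ∈ SCurr N from
    nsmul_mem key _
  refine ⟨fun g U hU => ?_, fun K hK => ?_⟩
  · have hU' : MeasurableSet (translate g ⁻¹' U) := (continuous_translate g).measurable hU
    rw [MeasureTheory.Measure.sum_apply _ hU', MeasureTheory.Measure.sum_apply _ hU,
      ← (ConjClass.conj g).tsum_eq
        (fun H' => MeasureTheory.Measure.dirac (limitPoint H'.1 (ConjClass.ne_bot h1 H')) U)]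
    refine tsum_congr fun H' => ?_
    rw [MeasureTheory.Measure.dirac_apply' _ hU', MeasureTheory.Measure.dirac_apply' _ hU]
    have : translate g (limitPoint H'.1 (ConjClass.ne_bot h1 H'))
        = limitPoint ((ConjClass.conj g) H').1 (ConjClass.ne_bot h1 _) :=
      Subtype.ext (image_limitSet g H'.1)
    rw [← this]
    rfl
  · set C := {p : (ℕ × Boundary N × Boundary N) // ∃ i < p.1, p.2.1.1 i ≠ p.2.2.1 i}
    let V : C → Set (SubsetSpace N) := fun p =>
      {S | (S.1 ∩ cyl p.1.1 p.1.2.1).Nonempty} ∩ {S | (S.1 ∩ cyl p.1.1 p.1.2.2).Nonempty}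
    have hVo : ∀ p, IsOpen (V p) := fun p => by
      let _ := TopologicalSpace.vietoris (Boundary N)
      exact ((TopologicalSpace.vietoris.isOpen_inter_nonempty_of_isOpen
        (isOpen_cyl _ _)).preimage continuous_induced_dom).inter
        ((TopologicalSpace.vietoris.isOpen_inter_nonempty_of_isOpen
        (isOpen_cyl _ _)).preimage continuous_induced_dom)
    have hcover : K ⊆ ⋃ p, V p := fun S _ => by
      obtain ⟨ξ, hξ, η, hη, hne⟩ := S.2.2
      obtain ⟨i, hi⟩ : ∃ i, ξ.1 i ≠ η.1 i := by
        by_contra! hcon; exact hne (Subtype.ext (funext hcon))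
      exact Set.mem_iUnion.2 ⟨⟨(i + 1, ξ, η), i, by simp, hi⟩,
        ⟨ξ, hξ, mem_cyl_self _ _⟩, ⟨η, hη, mem_cyl_self _ _⟩⟩
    obtain ⟨t, ht⟩ := hK.elim_finite_subcover V hVo hcover
    refine (MeasureTheory.measure_mono ht).trans_lt ?_
    refine (MeasureTheory.measure_biUnion_finset_le t V).trans_lt
      (ENNReal.sum_lt_top.2 fun p _ => ?_)
    have hfin : {H' : ConjClass (Subgroup.Commensurable.commensurator H) |
        limitPoint H'.1 (ConjClass.ne_bot h1 H') ∈ V p}.Finite := by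
      obtain ⟨R, hR⟩ := exists_bound hH p.1.1 p.1.2.1 p.1.2.2 p.2
      refine (((finite_norm_lt R).image fun g =>
        conjBy g (Subgroup.Commensurable.commensurator H)).preimage
          (Subtype.val_injective.injOn)).subset ?_
      intro H' hH'
      obtain ⟨g, hg⟩ := H'.2
      have hlim : limitSet H'.1 = boundaryAction N g '' limitSet H := by
        rw [hg, ← image_limitSet, limitSet_commensurator hH h1]
      have h2 : (limitSet H'.1 ∩ cyl p.1.1 p.1.2.1).Nonempty := hH'.1
      have h3 : (limitSet H'.1 ∩ cyl p.1.1 p.1.2.2).Nonempty := hH'.2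
      rw [hlim] at h2 h3
      obtain ⟨h, hh, hn⟩ := hR g h2 h3
      refine ⟨g * h, hn, ?_⟩
      show conjBy (g * h) _ = H'.1
      rw [hg]
      have hh' := le_commensurator H hh
      ext x
      rw [conjBy_mul, mem_conjBy, mem_conjBy, mem_conjBy, Subgroup.mul_mem_cancel_right _ hh',
        Subgroup.mul_mem_cancel_left _ (inv_mem hh')]
    rw [MeasureTheory.Measure.sum_apply _ (hVo p).measurableSet]
    rw [tsum_eq_sum (s := hfin.toFinset) fun H' hH' => by
      rw [MeasureTheory.Measure.dirac_apply' _ (hVo p).measurableSet]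
      exact Set.indicator_of_notMem (by simpa using hH') _]
    exact ENNReal.sum_lt_top.2 fun H' _ => MeasureTheory.measure_lt_top _ _

/-- The counting subset current of a finitely generated subgroup. -/
noncomputable def counting {N : ℕ} (H : Subgroup (FreeGroup (Fin N))) (hH : H.FG) : SCurr N :=
  ⟨countingMeasure H, countingMeasure_mem hH⟩

/-- The measure `∑_{HgK ∈ H\F_N/K} η_{H ∩ gKg⁻¹}`. The summand does not depend on the representative
`q.out` of the double coset `q`, since another representative gives a conjugate subgroup, and
`H ∩ gKg⁻¹` is finitely generated by Howson's theorem when `H` and `K` are. -/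
noncomputable def doubleCosetSum {N : ℕ} (H K : Subgroup (FreeGroup (Fin N))) :
    MeasureTheory.Measure (SubsetSpace N) :=
  MeasureTheory.Measure.sum
    fun q : DoubleCoset.Quotient (H : Set (FreeGroup (Fin N))) (K : Set (FreeGroup (Fin N))) =>
      countingMeasure (H ⊓ conjBy q.out K)

theorem fg_zpowers {N : ℕ} (g : FreeGroup (Fin N)) : (Subgroup.zpowers g).FG :=
  ⟨{g}, by rw [Finset.coe_singleton, Subgroup.zpowers_eq_closure]⟩

end SubsetCurrent

/-! ### Positive words, axes and cyclic subgroups of the free group. -/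

namespace SubsetCurrent

/-! Write `a`, `b` for the first two basis elements. In the Cayley tree the axis of `aⁿb` has `n +
1` vertices modulo translation, so exactly `n + 1` conjugates of `⟨aⁿb⟩` have an axis through the
identity: the groups `⟨aⁿ⁻ʲ b aʲ⟩` for `0 ≤ j ≤ n`. When `j` is far from both `0` and `n`, such an
axis follows the axis of `a` for a long time in both directions, so its pair of ends is close to the
limit set of `⟨a⟩`, the only conjugate of `⟨a⟩` whose axis passes through the identity. A test
function supported on `throughOne` therefore integrates against `η_⟨aⁿb⟩` to a sum of `n + 1`
values, all but boundedly many of them close to its integral against `η_⟨a⟩`. Dividing by `n` gives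
the limit (`averagesConverge_of_throughOne`). Any other test function is a finite sum of functions
supported on translates of the clopen set `throughOne`, and the currents are invariant
(`averagesConverge`).

The intersection product does not see this convergence. The exponent sum of `b` vanishes on every
conjugate of `⟨a⟩` and is injective on `⟨aⁿb⟩`, so all intersections are trivial and the product
with `η_⟨a⟩` is zero for every `n` (`doubleCosetSum_rotatedWord`). The product of `η_⟨a⟩` with
itself dominates `η_⟨a⟩`, through the double coset of the identity, and so charges the compact
clopen set `throughOne`. The indicator of that set is a test function separating this product from
zero. -/

theorem isReduced_invRev {α : Type*} [DecidableEq α] {L : List (α × Bool)}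
    (h : FreeGroup.IsReduced L) : FreeGroup.IsReduced (FreeGroup.invRev L) := by
  rw [FreeGroup.isReduced_iff_reduce_eq, FreeGroup.reduce_invRev, h.reduce_eq]

/-- If the reduced word `u` is not a prefix of the reduced word `z`, then the reduced word of
`u⁻¹ z` begins like that of `u⁻¹`. -/
theorem head?_toWord_inv_mul {α : Type*} [DecidableEq α] {u z : List (α × Bool)}
    (hu : FreeGroup.IsReduced u) (hz : FreeGroup.IsReduced z) (h : ¬ u <+: z) :
    ((FreeGroup.mk u)⁻¹ * FreeGroup.mk z).toWord.head? = (FreeGroup.invRev u).head? := by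
  induction u generalizing z with
  | nil => exact absurd List.nil_prefix h
  | cons s u ih =>
    have hinv : FreeGroup.invRev (s :: u) = FreeGroup.invRev u ++ [(s.1, !s.2)] := by
      simp [FreeGroup.invRev]
    -- Equal first letters cancel and the tails are compared. Otherwise `u⁻¹` followed by `z` is
    -- already reduced.
    by_cases hsz : ∃ z', z = s :: z'
    · obtain ⟨z, rfl⟩ := hsz
      have hpre : ¬ u <+: z := fun h' => h (List.cons_prefix_cons.2 ⟨rfl, h'⟩)
      have hne : FreeGroup.invRev u ≠ [] := fun h0 => hpre (by
        have : u = [] := by simpa [FreeGroup.invRev] using h0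
        rw [this]; exact List.nil_prefix)
      have heq : (FreeGroup.mk (s :: u))⁻¹ * FreeGroup.mk (s :: z)
          = (FreeGroup.mk u)⁻¹ * FreeGroup.mk z := by
        have h1 : ∀ t : List (α × Bool), FreeGroup.mk (s :: t)
            = FreeGroup.mk [s] * FreeGroup.mk t := fun t => rfl
        rw [h1 u, h1 z]; group
      rw [heq, hinv, List.head?_append_of_ne_nil _ hne]
      exact ih (hu.infix ⟨[s], [], by simp⟩) (hz.infix ⟨[s], [], by simp⟩) hpre
    · have hsz' : FreeGroup.IsReduced ([(s.1, !s.2)] ++ z) := by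
        rcases z with _ | ⟨t, z⟩
        · exact FreeGroup.IsReduced.singleton
        · rw [List.singleton_append, FreeGroup.isReduced_cons_cons]
          refine ⟨fun h1 => ?_, hz⟩
          by_contra h2
          refine hsz ⟨z, ?_⟩
          have : t = s := Prod.ext h1.symm (by
            simp only at h2
            cases hs : s.2 <;> cases ht : t.2 <;> simp_all)
          rw [this]
      have hred := FreeGroup.IsReduced.append_overlap (hinv ▸ isReduced_invRev hu) hsz' (by simp)
      rw [FreeGroup.inv_mk, FreeGroup.mul_mk, FreeGroup.toWord_mk, hinv, hred.reduce_eq]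
      simp

/-- All letters of the word are basis elements. -/
def IsPositive {α : Type*} (L : List (α × Bool)) : Prop := ∀ x ∈ L, x.2 = true

namespace IsPositive

variable {α : Type*} {L M : List (α × Bool)}

/-- Cancelling letters have opposite signs. Hence powers of a positive word are plain
concatenations. -/
theorem isReduced (h : IsPositive L) : FreeGroup.IsReduced L :=
  List.Pairwise.isChain (List.pairwise_iff_forall_sublist.2 fun {a b} hab _ => by
    rw [h a (hab.subset (by simp)), h b (hab.subset (by simp))])

theorem flatten_replicate (h : IsPositive L) (n : ℕ) :
    IsPositive (List.replicate n L).flatten := fun x hx => by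
  obtain ⟨l, hl, hxl⟩ := List.mem_flatten.1 hx
  rw [List.eq_of_mem_replicate hl] at hxl
  exact h x hxl

theorem append (h : IsPositive L) (h' : IsPositive M) : IsPositive (L ++ M) := fun x hx =>
  (List.mem_append.1 hx).elim (h x) (h' x)

variable [DecidableEq α]

theorem toWord_mk (h : IsPositive L) : (FreeGroup.mk L).toWord = L := by
  rw [FreeGroup.toWord_mk, h.isReduced.reduce_eq]

theorem toWord_mk_pow (h : IsPositive L) (n : ℕ) :
    (FreeGroup.mk L ^ n).toWord = (List.replicate n L).flatten := by
  rw [FreeGroup.pow_mk, (h.flatten_replicate n).toWord_mk]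

theorem toWord_inv_mk_pow (h : IsPositive L) (n : ℕ) :
    ((FreeGroup.mk L)⁻¹ ^ n).toWord = (List.replicate n (FreeGroup.invRev L)).flatten := by
  rw [inv_pow, FreeGroup.toWord_inv, h.toWord_mk_pow, invRev_flatten_replicate]

theorem mk_ne_one (h : IsPositive L) (hL : L ≠ []) : FreeGroup.mk L ≠ 1 := fun h1 => by
  rw [← FreeGroup.toWord_eq_nil_iff, h.toWord_mk] at h1
  exact hL h1

theorem mk_injective (h : IsPositive L) (h' : IsPositive M)
    (heq : FreeGroup.mk L = FreeGroup.mk M) : L = M := by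
  rw [← h.toWord_mk, heq, h'.toWord_mk]

end IsPositive

theorem prefix_flatten_replicate {α : Type*} {c p : List α} {m : ℕ}
    (h : p <+: (List.replicate m c).flatten) :
    ∃ q p', p' <+: c ∧ p = (List.replicate q c).flatten ++ p' := by
  induction m generalizing p with
  | zero => exact ⟨0, [], List.nil_prefix, by simpa using h⟩
  | succ m ih =>
    rw [List.replicate_succ, List.flatten_cons] at h
    rcases List.prefix_or_prefix_of_prefix h (List.prefix_append _ _) with h1 | ⟨p₁, rfl⟩
    · exact ⟨0, p, h1, by simp⟩
    · obtain ⟨q, p', hp', rfl⟩ := ih ((List.prefix_append_right_inj _).1 h)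
      exact ⟨q + 1, p', hp', by simp [List.replicate_succ]⟩

/-- A prefix of the reduced word of a power of `w` is the product of a power of `w` and a prefix
of `w`, if `w` is a positive word. -/
theorem mk_eq_zpow_mul_of_prefix {α : Type*} [DecidableEq α] {c p : List (α × Bool)}
    (hc : IsPositive c) {m : ℤ} (h : p <+: (FreeGroup.mk c ^ m).toWord) :
    ∃ (q : ℤ) (p' : List (α × Bool)), p' <+: c ∧
      FreeGroup.mk p = FreeGroup.mk c ^ q * FreeGroup.mk p' := by
  obtain ⟨m, rfl | rfl⟩ := m.eq_nat_or_neg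
  · rw [zpow_natCast, hc.toWord_mk_pow] at h
    obtain ⟨q, p', hp', rfl⟩ := prefix_flatten_replicate h
    exact ⟨q, p', hp', by rw [← FreeGroup.mul_mk, zpow_natCast, FreeGroup.pow_mk]⟩
  · rw [zpow_neg, zpow_natCast, ← inv_pow, hc.toWord_inv_mk_pow] at h
    obtain ⟨q, p', ⟨s, hs⟩, rfl⟩ := prefix_flatten_replicate h
    have hcs : c = FreeGroup.invRev s ++ FreeGroup.invRev p' := by
      rw [← FreeGroup.invRev_append, hs, FreeGroup.invRev_invRev]
    -- From `c⁻¹ = p' s` one gets `p' = c⁻¹ s⁻¹`, with `s⁻¹` a prefix of `c`. This costs one more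
    -- power of `c⁻¹`.
    refine ⟨-q - 1, FreeGroup.invRev s, ⟨_, hcs.symm⟩, ?_⟩
    have h1 : FreeGroup.mk c = (FreeGroup.mk s)⁻¹ * (FreeGroup.mk p')⁻¹ := by
      rw [FreeGroup.inv_mk, FreeGroup.inv_mk, FreeGroup.mul_mk, ← hcs]
    rw [← FreeGroup.mul_mk, ← FreeGroup.pow_mk, ← FreeGroup.inv_mk, ← FreeGroup.inv_mk,
      sub_eq_add_neg, zpow_add, mul_assoc, zpow_neg, zpow_natCast, inv_pow]
    congr 1
    rw [zpow_neg_one, h1]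
    group

theorem Agree.head? {N : ℕ} {k : ℕ} {g : FreeGroup (Fin N)} {ξ : Boundary N}
    (h : Agree (k + 1) g ξ) : g.toWord.head? = some (ξ.1 0) := by
  rw [List.head?_eq_getElem?, h 0 (by omega)]

/-- If two points of the limit set of a conjugate of `⟨w⟩`, with `w` a positive word, begin with
different letters, then the identity lies on the axis of the conjugate. -/
theorem inv_eq_zpow_mul_of_mem_limitSet {N : ℕ} {c : List (Fin N × Bool)} (hc : IsPositive c)
    {g : FreeGroup (Fin N)} {ξ η : Boundary N}
    (hξ : ξ ∈ limitSet (conjBy g (Subgroup.zpowers (FreeGroup.mk c))))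
    (hη : η ∈ limitSet (conjBy g (Subgroup.zpowers (FreeGroup.mk c)))) (hne : ξ.1 0 ≠ η.1 0) :
    ∃ (q : ℤ) (p : List (Fin N × Bool)), p <+: c ∧ g⁻¹ = FreeGroup.mk c ^ q * FreeGroup.mk p := by
  by_contra! hcon
  -- If `g⁻¹` is never a prefix of a power of `w`, every `g wᵐ` keeps the first letter of `g`, and
  -- so does every limit point.
  have key : ∀ ζ ∈ limitSet (conjBy g (Subgroup.zpowers (FreeGroup.mk c))),
      g.toWord.head? = some (ζ.1 0) := by
    intro ζ hζ
    -- Passing from `h = g wᵐ g⁻¹` to `h g` spoils at most `g.norm` letters, so one letter survives.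
    obtain ⟨h, hh, ha⟩ := mem_limitSet_iff.1 hζ (0 + 1 + g.norm)
    obtain ⟨m, hm⟩ := Subgroup.mem_zpowers_iff.1 (mem_conjBy.1 hh)
    have ha' := (agree_mul_right ha).head?
    rw [show h * g = g * FreeGroup.mk c ^ m by rw [hm]; group] at ha'
    have hpre : ¬ g⁻¹.toWord <+: (FreeGroup.mk c ^ m).toWord := fun hp => by
      obtain ⟨q, p, hp1, hp2⟩ := mk_eq_zpow_mul_of_prefix hc hp
      rw [FreeGroup.mk_toWord] at hp2
      exact hcon q p hp1 hp2
    have := head?_toWord_inv_mul FreeGroup.isReduced_toWord FreeGroup.isReduced_toWord hpre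
    rw [FreeGroup.mk_toWord, FreeGroup.mk_toWord, inv_inv, ha', FreeGroup.toWord_inv,
      FreeGroup.invRev_invRev] at this
    exact this.symm
  exact hne (Option.some_inj.1 ((key ξ hξ).symm.trans (key η hη)))

theorem conjBy_zpowers {N : ℕ} (g w : FreeGroup (Fin N)) :
    conjBy g (Subgroup.zpowers w) = Subgroup.zpowers (g * w * g⁻¹) := by
  rw [conjBy, MonoidHom.map_zpowers]; rfl

theorem conjBy_eq_self {N : ℕ} {g : FreeGroup (Fin N)} {H : Subgroup (FreeGroup (Fin N))}
    (hg : g ∈ H) : conjBy g H = H := by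
  ext x
  rw [mem_conjBy, Subgroup.mul_mem_cancel_right _ hg, Subgroup.mul_mem_cancel_left _ (inv_mem hg)]

/-- The constant ray `s s s …`. -/
def constRay {N : ℕ} (s : Fin N × Bool) : Boundary N :=
  ⟨fun _ => s, fun _ h => by simpa [letterInv] using congrArg Prod.snd h⟩

theorem agree_of_prefix {N : ℕ} {k : ℕ} {s : Fin N × Bool} {g : FreeGroup (Fin N)}
    (h : List.replicate k s <+: g.toWord) : Agree k g (constRay s) := fun i hi => by
  obtain ⟨t, ht⟩ := h
  rw [← ht, List.getElem?_append_left (by simpa using hi)]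
  simp [hi, constRay]

theorem mem_cyl_of_agree {N : ℕ} {k : ℕ} {g : FreeGroup (Fin N)} {ξ η : Boundary N}
    (h : Agree k g ξ) (h' : Agree k g η) : ξ ∈ cyl k η := fun i hi => by
  have := (h i hi).symm.trans (h' i hi)
  simpa using this

/-- The limit set of `⟨w⟩`, for a positive word `w` all of whose long positive powers begin with
`sᵏ` and all of whose long negative powers begin with `tᵏ`. -/
theorem limitSet_zpowers_subset {N : ℕ} {c : List (Fin N × Bool)} (hc : IsPositive c) {k : ℕ}
    {s t : Fin N × Bool}
    (hs : ∀ m, k ≤ (List.replicate m c).flatten.length →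
      List.replicate k s <+: (List.replicate m c).flatten)
    (ht : ∀ m, k ≤ (List.replicate m c).flatten.length →
      List.replicate k t <+: (List.replicate m (FreeGroup.invRev c)).flatten) :
    limitSet (Subgroup.zpowers (FreeGroup.mk c)) ⊆ cyl k (constRay s) ∪ cyl k (constRay t) := by
  intro ξ hξ
  obtain ⟨h, hh, ha⟩ := mem_limitSet_iff.1 hξ k
  obtain ⟨m, rfl⟩ := Subgroup.mem_zpowers_iff.1 hh
  have hlen := ha.le_norm
  obtain ⟨m, rfl | rfl⟩ := m.eq_nat_or_neg
  · rw [zpow_natCast] at ha hlen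
    rw [FreeGroup.norm, hc.toWord_mk_pow] at hlen
    exact .inl (mem_cyl_of_agree ha (agree_of_prefix (by rw [hc.toWord_mk_pow]; exact hs m hlen)))
  · rw [zpow_neg, zpow_natCast] at ha hlen
    rw [FreeGroup.norm_inv_eq, FreeGroup.norm, hc.toWord_mk_pow] at hlen
    refine .inr (mem_cyl_of_agree ha (agree_of_prefix ?_))
    rw [← inv_pow, hc.toWord_inv_mk_pow]
    exact ht m hlen

/-- The point is the limit of the positive powers. Assuming reduced powers instead of positivity
makes this applicable to the inverse word, hence to the other end of the axis. -/
theorem limitSet_zpowers_inter_nonempty {N : ℕ} {c : List (Fin N × Bool)}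
    (hred : ∀ n, FreeGroup.IsReduced (List.replicate n c).flatten) (hc0 : c ≠ []) {k : ℕ}
    {s : Fin N × Bool}
    (hs : ∀ m, k ≤ (List.replicate m c).flatten.length →
      List.replicate k s <+: (List.replicate m c).flatten) :
    (limitSet (Subgroup.zpowers (FreeGroup.mk c)) ∩ cyl k (constRay s)).Nonempty := by
  obtain ⟨ξ, hξ, -⟩ := exists_limit_point [] c hc0 (by simpa using fun n => hred (n + 1))
  have key : ∀ l, ∃ n, Agree l (FreeGroup.mk c ^ n) ξ := fun l => by
    obtain ⟨n, hn⟩ := hξ l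
    refine ⟨n + 1, fun i hi => ?_⟩
    rw [FreeGroup.pow_mk, FreeGroup.toWord_mk, (hred _).reduce_eq, ← hn i hi, List.nil_append]
  refine ⟨ξ, mem_limitSet_iff.2 fun l => ?_, ?_⟩
  · obtain ⟨n, hn⟩ := key l
    exact ⟨_, Subgroup.npow_mem_zpowers _ n, hn⟩
  · obtain ⟨n, hn⟩ := key k
    have hlen := hn.le_norm
    have hw : (FreeGroup.mk c ^ n).toWord = (List.replicate n c).flatten := by
      rw [FreeGroup.pow_mk, FreeGroup.toWord_mk, (hred _).reduce_eq]
    rw [FreeGroup.norm, hw] at hlen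
    exact mem_cyl_of_agree hn (agree_of_prefix (hw ▸ hs n hlen))

/-- The exponent sum of a basis element. -/
def exponentSum {N : ℕ} (b : Fin N) : FreeGroup (Fin N) →* Multiplicative ℤ :=
  FreeGroup.lift fun i => if i = b then Multiplicative.ofAdd 1 else 1

/-- The word `aⁿ⁻ʲ b aʲ`. -/
def rotatedWord {N : ℕ} (a b : Fin N) (n j : ℕ) : List (Fin N × Bool) :=
  List.replicate (n - j) (a, true) ++ (b, true) :: List.replicate j (a, true)

theorem isPositive_replicate {N : ℕ} (a : Fin N) (k : ℕ) :
    IsPositive (List.replicate k (a, true)) := fun x hx => by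
  rw [List.eq_of_mem_replicate hx]

theorem isPositive_rotatedWord {N : ℕ} (a b : Fin N) (n j : ℕ) :
    IsPositive (rotatedWord a b n j) :=
  (isPositive_replicate a _).append fun x hx => by
    rcases List.mem_cons.1 hx with rfl | hx
    · rfl
    · exact isPositive_replicate a _ x hx

theorem rotatedWord_ne_nil {N : ℕ} (a b : Fin N) (n j : ℕ) : rotatedWord a b n j ≠ [] := by
  simp [rotatedWord]

theorem mk_replicate {N : ℕ} (a : Fin N) (k : ℕ) :
    FreeGroup.mk (List.replicate k (a, true)) = FreeGroup.of a ^ k := by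
  rw [FreeGroup.of, FreeGroup.pow_mk]; simp

theorem mk_rotatedWord {N : ℕ} (a b : Fin N) (n j : ℕ) :
    FreeGroup.mk (rotatedWord a b n j)
      = FreeGroup.of a ^ (n - j) * FreeGroup.of b * FreeGroup.of a ^ j := by
  rw [← mk_replicate, ← mk_replicate, FreeGroup.of, FreeGroup.mul_mk, FreeGroup.mul_mk]
  simp [rotatedWord]

theorem mk_rotatedWord_zero {N : ℕ} (a b : Fin N) (n : ℕ) :
    FreeGroup.mk (rotatedWord a b n 0) = FreeGroup.of a ^ n * FreeGroup.of b := by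
  simp [mk_rotatedWord]

/-- The double inverse is the shape that `conjBy_zpowers` produces for the conjugator `a⁻ʲ`. -/
theorem mk_rotatedWord_eq_conj {N : ℕ} (a b : Fin N) {n j : ℕ} (hj : j ≤ n) :
    FreeGroup.mk (rotatedWord a b n j) = (FreeGroup.of a ^ j)⁻¹ *
      FreeGroup.mk (rotatedWord a b n 0) * ((FreeGroup.of a ^ j)⁻¹)⁻¹ := by
  rw [mk_rotatedWord, mk_rotatedWord_zero, pow_sub _ hj, (Commute.pow_pow_self _ n j).inv_right.eq]
  group

variable {N : ℕ} {a b : Fin N}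

theorem exponentSum_mk_rotatedWord (hab : a ≠ b) (n j : ℕ) :
    exponentSum b (FreeGroup.mk (rotatedWord a b n j)) = Multiplicative.ofAdd 1 := by
  simp [mk_rotatedWord, exponentSum, hab]

/-- The exponent sum identifies `⟨w⟩` with `ℤ`. This is behind the distinctness of the rotated
groups, their commensurators and the trivial intersections. -/
theorem eq_of_mem_zpowers_of_exponentSum_eq {w x : FreeGroup (Fin N)}
    (hw : exponentSum b w = Multiplicative.ofAdd 1) {k : ℤ}
    (hx : exponentSum b x = Multiplicative.ofAdd k) (h : x ∈ Subgroup.zpowers w) : x = w ^ k := by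
  obtain ⟨m, rfl⟩ := Subgroup.mem_zpowers_iff.1 h
  rw [map_zpow, hw, ← ofAdd_zsmul] at hx
  have : m = k := by simpa using hx
  rw [this]

theorem mk_rotatedWord_injOn (hab : a ≠ b) {n i j : ℕ} (hi : i ≤ n) (hj : j ≤ n)
    (h : FreeGroup.mk (rotatedWord a b n i) = FreeGroup.mk (rotatedWord a b n j)) : i = j := by
  have := (isPositive_rotatedWord a b n i).mk_injective (isPositive_rotatedWord a b n j) h
  by_contra hne
  wlog hlt : i < j generalizing i j
  · exact this hj hi h.symm ‹_ = _›.symm (Ne.symm hne) (by omega)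
  -- Position `n - j` holds the only `b` of the `j`-th word, but still an `a` in the `i`-th, as `n -
  -- j < n - i`.
  have h2 := congrArg (fun l => l[n - j]?) this
  simp [rotatedWord, List.getElem?_append, show n - j < n - i by omega, hab] at h2

/-- Both generators have exponent sum `1`, which rules out that they are inverse to each other. -/
theorem zpowers_rotatedWord_injOn (hab : a ≠ b) {n i j : ℕ} (hi : i ≤ n) (hj : j ≤ n)
    (h : Subgroup.zpowers (FreeGroup.mk (rotatedWord a b n i))
      = Subgroup.zpowers (FreeGroup.mk (rotatedWord a b n j))) : i = j := by
  refine mk_rotatedWord_injOn hab hi hj ?_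
  have := eq_of_mem_zpowers_of_exponentSum_eq (exponentSum_mk_rotatedWord hab n j)
    (exponentSum_mk_rotatedWord hab n i) (h ▸ Subgroup.mem_zpowers _)
  rw [this, zpow_one]

theorem prefix_rotatedWord_zero {n : ℕ} {p : List (Fin N × Bool)}
    (h : p <+: rotatedWord a b n 0) :
    (∃ r ≤ n, FreeGroup.mk p = FreeGroup.of a ^ r) ∨ p = rotatedWord a b n 0 := by
  rw [rotatedWord, List.replicate_zero, Nat.sub_zero, List.prefix_concat_iff] at h
  rcases h with rfl | h
  · right; simp [rotatedWord]
  · left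
    rw [List.prefix_replicate_iff] at h
    exact ⟨p.length, h.1, by rw [← mk_replicate, ← h.2]⟩

/-- A conjugate of `⟨aⁿb⟩` whose limit set contains two points with different first letters is
one of the `⟨aⁿ⁻ʲ b aʲ⟩`. -/
theorem exists_inv_eq_of_mem_limitSet_rotatedWord {n : ℕ} {g : FreeGroup (Fin N)}
    {ξ η : Boundary N}
    (hξ : ξ ∈ limitSet (conjBy g (Subgroup.zpowers (FreeGroup.mk (rotatedWord a b n 0)))))
    (hη : η ∈ limitSet (conjBy g (Subgroup.zpowers (FreeGroup.mk (rotatedWord a b n 0)))))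
    (hne : ξ.1 0 ≠ η.1 0) :
    ∃ r ≤ n, ∃ q : ℤ, g⁻¹ = FreeGroup.mk (rotatedWord a b n 0) ^ q * FreeGroup.of a ^ r := by
  obtain ⟨q, p, hp, hg⟩ :=
    inv_eq_zpow_mul_of_mem_limitSet (isPositive_rotatedWord a b n 0) hξ hη hne
  rcases prefix_rotatedWord_zero hp with ⟨r, hr, hpr⟩ | rfl
  · exact ⟨r, hr, q, by rw [hg, hpr]⟩
  -- The full word as a prefix is absorbed into the power.
  · exact ⟨0, Nat.zero_le _, q + 1, by rw [hg, zpow_add_one, pow_zero, mul_one]⟩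

theorem conjBy_zpowers_rotatedWord {n r : ℕ} (hr : r ≤ n) {q : ℤ} {g : FreeGroup (Fin N)}
    (hg : g⁻¹ = FreeGroup.mk (rotatedWord a b n 0) ^ q * FreeGroup.of a ^ r) :
    conjBy g (Subgroup.zpowers (FreeGroup.mk (rotatedWord a b n 0)))
      = Subgroup.zpowers (FreeGroup.mk (rotatedWord a b n r)) := by
  rw [← inv_inv g, hg, mul_inv_rev, conjBy_mul,
    conjBy_eq_self (inv_mem (Subgroup.zpow_mem_zpowers _ q)), conjBy_zpowers,
    ← mk_rotatedWord_eq_conj a b hr]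

theorem isPositive_singleton (a : Fin N) : IsPositive [(a, true)] := isPositive_replicate a 1

/-- The vertices on the axis of `a` are exactly the powers of `a`, so `⟨a⟩` is its only conjugate
with axis through the identity. -/
theorem mem_zpowers_of_mem_limitSet {g : FreeGroup (Fin N)} {ξ η : Boundary N}
    (hξ : ξ ∈ limitSet (conjBy g (Subgroup.zpowers (FreeGroup.of a))))
    (hη : η ∈ limitSet (conjBy g (Subgroup.zpowers (FreeGroup.of a))))
    (hne : ξ.1 0 ≠ η.1 0) : g ∈ Subgroup.zpowers (FreeGroup.of a) := by
  obtain ⟨q, p, hp, hg⟩ := inv_eq_zpow_mul_of_mem_limitSet (isPositive_singleton a) hξ hη hne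
  rw [← inv_mem_iff, hg]
  refine mul_mem (Subgroup.zpow_mem_zpowers _ q) ?_
  rw [show [(a, true)] = List.replicate 1 (a, true) from rfl, List.prefix_replicate_iff] at hp
  rw [hp.2, mk_replicate]
  exact Subgroup.npow_mem_zpowers _ _

theorem replicate_one_prefix_flatten {α : Type*} {c : List α} (hc : c ≠ []) {m : ℕ}
    (hm : m ≠ 0) : List.replicate 1 (c.head hc) <+: (List.replicate m c).flatten := by
  obtain ⟨m, rfl⟩ := Nat.exists_eq_add_one_of_ne_zero hm
  rw [List.replicate_succ (n := m), List.flatten_cons]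
  exact List.IsPrefix.trans ⟨c.tail, by simp⟩ (List.prefix_append _ _)

theorem isReduced_flatten_replicate_invRev {c : List (Fin N × Bool)} (hc : IsPositive c) (n : ℕ) :
    FreeGroup.IsReduced (List.replicate n (FreeGroup.invRev c)).flatten := by
  rw [← invRev_flatten_replicate]
  exact isReduced_invRev (hc.flatten_replicate n).isReduced

theorem invRev_ne_nil {α : Type*} {c : List (α × Bool)} (hc : c ≠ []) :
    FreeGroup.invRev c ≠ [] := fun h => hc (by simpa [FreeGroup.invRev] using h)

theorem zpowers_mk_invRev (c : List (Fin N × Bool)) :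
    Subgroup.zpowers (FreeGroup.mk (FreeGroup.invRev c)) = Subgroup.zpowers (FreeGroup.mk c) := by
  rw [← FreeGroup.inv_mk, Subgroup.zpowers_inv]

/-- The limit set of a positive word contains points with different first letters. -/
theorem exists_mem_limitSet_zpowers_ne {c : List (Fin N × Bool)} (hc : IsPositive c)
    (hc0 : c ≠ []) :
    ∃ ξ ∈ limitSet (Subgroup.zpowers (FreeGroup.mk c)),
      ∃ η ∈ limitSet (Subgroup.zpowers (FreeGroup.mk c)), ξ.1 0 ≠ η.1 0 := by
  have hm : ∀ (d : List (Fin N × Bool)) (m : ℕ), 1 ≤ (List.replicate m d).flatten.length →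
      m ≠ 0 := by rintro d m h rfl; simp at h
  obtain ⟨ξ, hξ, hξ'⟩ := limitSet_zpowers_inter_nonempty
    (fun n => (hc.flatten_replicate n).isReduced) hc0 (fun m h => replicate_one_prefix_flatten hc0 (hm c m h))
  obtain ⟨η, hη, hη'⟩ := limitSet_zpowers_inter_nonempty (isReduced_flatten_replicate_invRev hc)
    (invRev_ne_nil hc0) (fun m h => replicate_one_prefix_flatten (invRev_ne_nil hc0) (hm _ m h))
  rw [zpowers_mk_invRev] at hη
  refine ⟨ξ, hξ, η, hη, fun h => ?_⟩
  rw [hξ' 0 one_pos, hη' 0 one_pos] at h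
  -- The signs differ: one ray begins with the head of `c`, the other with the inverse of its last
  -- letter.
  have h2 := congrArg Prod.snd h
  have h3 : (FreeGroup.invRev c).head (invRev_ne_nil hc0)
      = letterInv (c.getLast hc0) := by
    simp [FreeGroup.invRev, letterInv, List.head_reverse, List.getLast_map]
  simp only [constRay] at h2
  rw [h3, hc _ (List.head_mem hc0), letterInv, hc _ (List.getLast_mem hc0)] at h2
  simp at h2

theorem limitSet_conjBy_of_mem_commensurator {H : Subgroup (FreeGroup (Fin N))}
    {g : FreeGroup (Fin N)} (hg : g ∈ Subgroup.Commensurable.commensurator H) :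
    limitSet (conjBy g H) = limitSet H := by
  rw [← image_limitSet]
  refine (image_limitSet_subset_of_mem hg).antisymm fun ξ hξ => ?_
  refine ⟨boundaryAction N g⁻¹ ξ,
    image_limitSet_subset_of_mem (inv_mem hg) (Set.mem_image_of_mem _ hξ), ?_⟩
  rw [← Homeomorph.mul_apply, ← map_mul, mul_inv_cancel, map_one, Homeomorph.one_apply]

/-- A commensurating `g` fixes the limit set, so the axis of `g⟨a⟩g⁻¹` also passes through the
identity. -/
theorem commensurator_zpowers_of (a : Fin N) :
    Subgroup.Commensurable.commensurator (Subgroup.zpowers (FreeGroup.of a))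
      = Subgroup.zpowers (FreeGroup.of a) := by
  refine le_antisymm (fun g hg => ?_) (le_commensurator _)
  obtain ⟨ξ, hξ, η, hη, hne⟩ :=
    exists_mem_limitSet_zpowers_ne (isPositive_singleton a) (List.cons_ne_nil _ _)
  have h := limitSet_conjBy_of_mem_commensurator hg
  exact mem_zpowers_of_mem_limitSet (h ▸ hξ) (h ▸ hη) hne

theorem commensurator_zpowers_rotatedWord (hab : a ≠ b) (n : ℕ) :
    Subgroup.Commensurable.commensurator
        (Subgroup.zpowers (FreeGroup.mk (rotatedWord a b n 0)))
      = Subgroup.zpowers (FreeGroup.mk (rotatedWord a b n 0)) := by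
  refine le_antisymm (fun g hg => ?_) (le_commensurator _)
  obtain ⟨ξ, hξ, η, hη, hne⟩ := exists_mem_limitSet_zpowers_ne (isPositive_rotatedWord a b n 0)
    (rotatedWord_ne_nil a b n 0)
  have h := limitSet_conjBy_of_mem_commensurator hg
  obtain ⟨r, hr, q, hq⟩ := exists_inv_eq_of_mem_limitSet_rotatedWord (h ▸ hξ) (h ▸ hη) hne
  have hcomm := (Subgroup.Commensurable.commensurator_mem_iff _ g).1 hg
  rw [toConjAct_smul, conjBy_zpowers_rotatedWord hr hq] at hcomm
  -- So far `g` may rotate the word by `r`. Commensurability puts a positive power of the rotated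
  -- word in `⟨aⁿb⟩`, the exponent sum makes it the same power of `aⁿb`, and uniqueness of roots
  -- gives `r = 0`.
  obtain ⟨k, hk, -, hmem⟩ :=
    Subgroup.exists_pow_mem_of_relIndex_ne_zero hcomm.2 (Subgroup.mem_zpowers _)
  have hpow := eq_of_mem_zpowers_of_exponentSum_eq (exponentSum_mk_rotatedWord hab n 0)
    (k := k) (by rw [map_pow, exponentSum_mk_rotatedWord hab, ← ofAdd_nsmul]; simp) hmem.1
  rw [zpow_natCast] at hpow
  have hr0 := mk_rotatedWord_injOn hab hr (Nat.zero_le n) (pow_left_injective hk.ne' hpow)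
  rw [← inv_mem_iff, hq, hr0, pow_zero, mul_one]
  exact Subgroup.zpow_mem_zpowers _ q

/-- The exponent sum of `b` is zero on conjugates of `⟨a⟩` and injective on the first group. -/
theorem zpowers_rotatedWord_inf_conjBy (hab : a ≠ b) (n j : ℕ) (g : FreeGroup (Fin N)) :
    Subgroup.zpowers (FreeGroup.mk (rotatedWord a b n j))
      ⊓ conjBy g (Subgroup.zpowers (FreeGroup.of a)) = ⊥ := by
  refine (Subgroup.eq_bot_iff_forall _).2 fun x ⟨hx, hx'⟩ => ?_
  have h0 : exponentSum b x = Multiplicative.ofAdd 0 := by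
    obtain ⟨m, hm⟩ := Subgroup.mem_zpowers_iff.1 (mem_conjBy.1 hx')
    have := congrArg (exponentSum b) hm
    simpa [exponentSum, hab] using this.symm
  rw [eq_of_mem_zpowers_of_exponentSum_eq (exponentSum_mk_rotatedWord hab n j) h0 hx, zpow_zero]

end SubsetCurrent

/-! ### Topology of the space of closed subsets, and an averaging lemma. -/

namespace SubsetCurrent

open Filter Topology MeasureTheory

section Space

variable {N : ℕ}

theorem continuous_letter (i : ℕ) : Continuous fun ξ : Boundary N => ξ.1 i :=
  (continuous_apply i).comp continuous_subtype_val

instance : CompactSpace (Boundary N) := by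
  have hclosed : IsClosed {w : ℕ → Fin N × Bool | ∀ i, w (i + 1) ≠ letterInv (w i)} := by
    simp only [Set.ofPred_forall]
    refine isClosed_iInter fun i => ?_
    have h : Continuous fun w : ℕ → Fin N × Bool => (w i, w (i + 1)) :=
      (continuous_apply i).prodMk (continuous_apply (i + 1))
    exact (isClosed_discrete {p : (Fin N × Bool) × (Fin N × Bool) | p.2 ≠ letterInv p.1}).preimage h
  exact isCompact_iff_compactSpace.1 hclosed.isCompact

instance : T2Space (Boundary N) :=
  inferInstanceAs (T2Space {w : ℕ → Fin N × Bool // ∀ i, w (i + 1) ≠ letterInv (w i)})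

theorem exists_cyl_subset {U : Set (Boundary N)} (hU : IsOpen U) {ξ : Boundary N} (hξ : ξ ∈ U) :
    ∃ k, cyl k ξ ⊆ U := by
  obtain ⟨V, hV, rfl⟩ := isOpen_induced_iff.1 hU
  obtain ⟨I, u, hu, hsub⟩ := isOpen_pi_iff.1 hV _ hξ
  refine ⟨I.sup id + 1, fun η hη => hsub fun i hi => ?_⟩
  have : η.1 i = ξ.1 i := hη i (Nat.lt_succ_of_le (Finset.le_sup (f := id) hi))
  rw [this]
  exact (hu i hi).2

theorem cyl_anti {k l : ℕ} (h : k ≤ l) (ξ : Boundary N) : cyl l ξ ⊆ cyl k ξ :=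
  fun _ hη i hi => hη i (hi.trans_le h)

/-- The closed sets that contain two points with different first letters, that is, whose convex
hull in the Cayley tree contains the identity. -/
def throughOne (N : ℕ) : Set (SubsetSpace N) :=
  {S | ∃ ξ ∈ S.1, ∃ η ∈ S.1, ξ.1 0 ≠ η.1 0}

/-- A finite union of conditions of meeting clopen sets, the form from which clopenness and
compactness are read off. -/
theorem throughOne_eq : throughOne N = ⋃ p : {p : (Fin N × Bool) × (Fin N × Bool) // p.1 ≠ p.2},
    ({S : SubsetSpace N | (S.1 ∩ {ξ | ξ.1 0 = p.1.1}).Nonempty} ∩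
      {S | (S.1 ∩ {ξ | ξ.1 0 = p.1.2}).Nonempty}) := by
  ext S
  simp only [throughOne, Set.mem_iUnion]
  constructor
  · rintro ⟨ξ, hξ, η, hη, hne⟩
    exact ⟨⟨(ξ.1 0, η.1 0), hne⟩, ⟨ξ, hξ, rfl⟩, η, hη, rfl⟩
  · rintro ⟨⟨⟨x, y⟩, hne⟩, ⟨ξ, hξ, h1⟩, η, hη, h2⟩
    refine ⟨ξ, hξ, η, hη, ?_⟩
    rw [show ξ.1 0 = x from h1, show η.1 0 = y from h2]
    exact hne

theorem isClopen_letter (i : ℕ) (x : Fin N × Bool) : IsClopen {ξ : Boundary N | ξ.1 i = x} :=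
  (isClopen_discrete {x}).preimage (continuous_letter i)

theorem isClopen_inter_nonempty {C : Set (Boundary N)} (hC : IsClopen C) :
    IsClopen {S : SubsetSpace N | (S.1 ∩ C).Nonempty} := by
  let _ := TopologicalSpace.vietoris (Boundary N)
  exact ⟨(TopologicalSpace.vietoris.isClosed_inter_nonempty_of_isClosed hC.1).preimage
      continuous_induced_dom,
    (TopologicalSpace.vietoris.isOpen_inter_nonempty_of_isOpen hC.2).preimage
      continuous_induced_dom⟩

theorem isClopen_throughOne : IsClopen (throughOne N) := by
  rw [throughOne_eq]
  exact isClopen_iUnion_of_finite fun p =>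
    (isClopen_inter_nonempty (isClopen_letter 0 p.1.1)).inter
      (isClopen_inter_nonempty (isClopen_letter 0 p.1.2))

/-- A limit of sets with two points may degenerate to one point, but not if the sets meet two fixed
disjoint clopen sets. Thus the same conditions cut out a closed set `Q` in the compact space of all
nonempty compact subsets, and `Q` contains no singletons. -/
theorem isCompact_throughOne : IsCompact (throughOne N) := by
  let _ := TopologicalSpace.vietoris (Boundary N)
  have hind : IsInducing (fun S : SubsetSpace N => S.1) := ⟨rfl⟩
  rw [hind.isCompact_iff]
  set Q : Set (TopologicalSpace.NonemptyCompacts (Boundary N)) :=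
    ⋃ p : {p : (Fin N × Bool) × (Fin N × Bool) // p.1 ≠ p.2},
      ({S | ((S : Set (Boundary N)) ∩ {ξ | ξ.1 0 = p.1.1}).Nonempty} ∩
        {S | ((S : Set (Boundary N)) ∩ {ξ | ξ.1 0 = p.1.2}).Nonempty}) with hQ
  have hQc : IsClosed Q := isClosed_iUnion_of_finite fun p =>
    (TopologicalSpace.NonemptyCompacts.isClosed_inter_nonempty_of_isClosed
      (isClopen_letter 0 p.1.1).1).inter
    (TopologicalSpace.NonemptyCompacts.isClosed_inter_nonempty_of_isClosed
      (isClopen_letter 0 p.1.2).1)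
  have himage : (fun S : SubsetSpace N => S.1) '' throughOne N
      = (fun K : TopologicalSpace.NonemptyCompacts (Boundary N) => (K : Set (Boundary N))) ''
        Q := by
    rw [throughOne_eq]
    ext S
    constructor
    · rintro ⟨S, hS, rfl⟩
      exact ⟨⟨⟨S.1, S.2.1.isCompact⟩, S.2.2.nonempty⟩, by simpa [hQ] using hS, rfl⟩
    · rintro ⟨K, hK, rfl⟩
      obtain ⟨⟨⟨x, y⟩, hp⟩, ⟨ξ, hξ, hx⟩, ⟨η, hη, hy⟩⟩ := Set.mem_iUnion.1 hK
      refine ⟨⟨K, K.isCompact.isClosed, ξ, hξ, η, hη, ?_⟩,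
        Set.mem_iUnion.2 ⟨⟨(x, y), hp⟩, ⟨ξ, hξ, hx⟩, ⟨η, hη, hy⟩⟩, rfl⟩
      rintro rfl
      exact hp (hx.symm.trans hy)
  rw [himage]
  exact hQc.isCompact.image TopologicalSpace.NonemptyCompacts.continuous_coe

theorem translate_mul (g h : FreeGroup (Fin N)) (S : SubsetSpace N) :
    translate (g * h) S = translate g (translate h S) := Subtype.ext (by
  show boundaryAction N (g * h) '' S.1 = boundaryAction N g '' (boundaryAction N h '' S.1)
  rw [map_mul, ← Set.image_comp]; rfl)

theorem translate_one (S : SubsetSpace N) : translate 1 S = S := Subtype.ext (by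
  show boundaryAction N 1 '' S.1 = S.1
  rw [map_one]; exact Set.image_id _)

def translateHomeo (g : FreeGroup (Fin N)) : SubsetSpace N ≃ₜ SubsetSpace N where
  toFun := translate g
  invFun := translate g⁻¹
  left_inv S := by rw [← translate_mul, inv_mul_cancel, translate_one]
  right_inv S := by rw [← translate_mul, mul_inv_cancel, translate_one]
  continuous_toFun := continuous_translate g
  continuous_invFun := continuous_translate g⁻¹

/-- Translating by the inverse of the common prefix moves the branch point of the two rays to the
identity. -/
theorem exists_boundaryAction_letter_ne {ξ η : Boundary N} {m : ℕ} (h : ξ.1 m ≠ η.1 m) :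
    ∃ g : FreeGroup (Fin N), (boundaryAction N g ξ).1 0 ≠ (boundaryAction N g η).1 0 := by
  induction m generalizing ξ η with
  | zero => exact ⟨1, by simpa using h⟩
  | succ m ih =>
    by_cases h0 : ξ.1 0 = η.1 0
    · have hs : ∀ ζ : Boundary N, ζ.1 0 = ξ.1 0 → ∀ i,
          (step (letterInv (ξ.1 0)) ζ).1 i = ζ.1 (i + 1) := fun ζ hζ i => by
        rw [step_apply, if_pos (by rw [letterInv_letterInv, hζ])]
      obtain ⟨g, hg⟩ := ih (ξ := step (letterInv (ξ.1 0)) ξ) (η := step (letterInv (ξ.1 0)) η)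
        (by rwa [hs ξ rfl, hs η h0.symm])
      refine ⟨g * FreeGroup.mk [letterInv (ξ.1 0)], ?_⟩
      rwa [map_mul, Homeomorph.mul_apply, Homeomorph.mul_apply, boundaryAction_mk_singleton,
        boundaryAction_mk_singleton]
    · exact ⟨1, by simpa using h0⟩

theorem exists_translate_mem_throughOne (S : SubsetSpace N) :
    ∃ g, translate g S ∈ throughOne N := by
  obtain ⟨ξ, hξ, η, hη, hne⟩ := S.2.2
  obtain ⟨i, hi⟩ : ∃ i, ξ.1 i ≠ η.1 i := by
    by_contra! hcon; exact hne (Subtype.ext (funext hcon))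
  obtain ⟨g, hg⟩ := exists_boundaryAction_letter_ne hi
  exact ⟨g, _, Set.mem_image_of_mem _ hξ, _, Set.mem_image_of_mem _ hη, hg⟩

/-- The closed sets contained in the union of two cylinders and meeting both. -/
def pairNhd (k : ℕ) (ξ η : Boundary N) : Set (SubsetSpace N) :=
  {S | S.1 ⊆ cyl k ξ ∪ cyl k η ∧ (S.1 ∩ cyl k ξ).Nonempty ∧ (S.1 ∩ cyl k η).Nonempty}

theorem pairNhd_anti (ξ η : Boundary N) : Antitone fun k => pairNhd k ξ η :=
  fun _ _ h _ ⟨h1, h2, h3⟩ => ⟨h1.trans (Set.union_subset_union (cyl_anti h ξ) (cyl_anti h η)),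
    h2.mono (Set.inter_subset_inter_right _ (cyl_anti h ξ)),
    h3.mono (Set.inter_subset_inter_right _ (cyl_anti h η))⟩

theorem eq_of_forall_mem_cyl {ξ η : Boundary N} (h : ∀ k, ξ ∈ cyl k η) : ξ = η :=
  Subtype.ext (funext fun i => h (i + 1) i (Nat.lt_succ_self i))

theorem eq_pair_of_forall_mem_pairNhd {ξ η : Boundary N} {S : SubsetSpace N}
    (h : ∀ k, S ∈ pairNhd k ξ η) : S.1 = {ξ, η} := by
  have hmem : ∀ θ : Boundary N, (∀ k, (S.1 ∩ cyl k θ).Nonempty) → θ ∈ S.1 := fun θ hθ => by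
    refine S.2.1.closure_subset (mem_closure_iff.2 fun U hU hθU => ?_)
    obtain ⟨k, hk⟩ := exists_cyl_subset hU hθU
    obtain ⟨ζ, hζ, hζ'⟩ := hθ k
    exact ⟨ζ, hk hζ', hζ⟩
  refine Set.Subset.antisymm (fun ζ hζ => ?_) (Set.pair_subset (hmem ξ fun k => (h k).2.1)
    (hmem η fun k => (h k).2.2))
  by_contra hcon
  simp only [Set.mem_insert_iff, Set.mem_singleton_iff, not_or] at hcon
  obtain ⟨k, hk⟩ : ∃ k, ζ ∉ cyl k ξ := by
    by_contra! hc; exact hcon.1 (eq_of_forall_mem_cyl hc)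
  obtain ⟨l, hl⟩ : ∃ l, ζ ∉ cyl l η := by
    by_contra! hc; exact hcon.2 (eq_of_forall_mem_cyl hc)
  rcases (h (max k l)).1 hζ with h1 | h1
  · exact hk (cyl_anti (le_max_left k l) ξ h1)
  · exact hl (cyl_anti (le_max_right k l) η h1)

/-- Here `S = {ξ, η}`. As the sets `pairNhd` are nested, it suffices to find one inside each
subbasic Vietoris neighbourhood: the subsets of an open set, or the sets meeting it. -/
theorem exists_pairNhd_subset {ξ η : Boundary N} {S : SubsetSpace N}
    (h : ∀ k, S ∈ pairNhd k ξ η) {W : Set (SubsetSpace N)} (hW : W ∈ 𝓝 S) :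
    ∃ k, pairNhd k ξ η ⊆ W := by
  have hS := eq_pair_of_forall_mem_pairNhd h
  have hbasis := hasBasis_iInf_principal (directed_of_isDirected_le (pairNhd_anti ξ η))
  suffices hle : (⨅ k, 𝓟 (pairNhd k ξ η)) ≤ 𝓝 S by
    obtain ⟨k, -, hk⟩ := hbasis.mem_iff.1 (hle hW)
    exact ⟨k, hk⟩
  let _ := TopologicalSpace.vietoris (Boundary N)
  have hind : IsInducing (fun S : SubsetSpace N => S.1) := ⟨rfl⟩
  rw [hind.nhds_eq_comap, ← map_le_iff_le_comap]
  refine TopologicalSpace.tendsto_nhds_generateFrom_iff.2 ?_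
  rintro _ (⟨U, hU, rfl⟩ | ⟨U, hU, rfl⟩) hSU
  · have hsub : ({ξ, η} : Set (Boundary N)) ⊆ U := hS ▸ hSU
    obtain ⟨k, hk⟩ := exists_cyl_subset hU (hsub (Set.mem_insert _ _))
    obtain ⟨l, hl⟩ := exists_cyl_subset hU (hsub (Set.mem_insert_of_mem _ rfl))
    refine hbasis.mem_iff.2 ⟨max k l, trivial, fun T hT => hT.1.trans (Set.union_subset ?_ ?_)⟩
    · exact (cyl_anti (le_max_left k l) ξ).trans hk
    · exact (cyl_anti (le_max_right k l) η).trans hl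
  · obtain ⟨ζ, hζ, hζU⟩ : (S.1 ∩ U).Nonempty := hSU
    obtain ⟨k, hk⟩ := exists_cyl_subset hU hζU
    refine hbasis.mem_iff.2 ⟨k, trivial, fun T hT => ?_⟩
    rw [hS] at hζ
    rcases hζ with rfl | rfl
    · exact hT.2.1.mono (Set.inter_subset_inter_right _ hk)
    · exact hT.2.2.mono (Set.inter_subset_inter_right _ hk)

end Space

/-- Cesàro type averaging: if the terms of a triangular array are close to `L` away from the two
ends of each row, then the averages of the rows converge to `L`. -/
theorem tendsto_average_of_close {F : ℕ → ℕ → ℝ} {L C : ℝ} (hC : ∀ n j, |F n j - L| ≤ C)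
    (hF : ∀ ε > 0, ∃ k, ∀ n j, k ≤ j → j + k ≤ n → |F n j - L| ≤ ε) :
    Tendsto (fun n : ℕ => (n : ℝ)⁻¹ * ∑ j ∈ Finset.range (n + 1), F n j) atTop (𝓝 L) := by
  have hC0 : 0 ≤ C := (abs_nonneg _).trans (hC 0 0)
  rw [Metric.tendsto_atTop]
  intro ε hε
  -- The `n + 1` small errors contribute at most `ε / 2` after division by `n`. The end terms and
  -- the surplus `L` contribute less than `ε / 4` for large `n`.
  obtain ⟨k, hk⟩ := hF (ε / 4) (by positivity)
  obtain ⟨M, hM⟩ := exists_nat_gt ((2 * k * C + |L| + 1) / (ε / 4))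
  refine ⟨M + 1, fun n hn => ?_⟩
  have hn0 : (0 : ℝ) < n := by exact_mod_cast (by omega : 0 < n)
  have hn1 : (1 : ℝ) ≤ n := by exact_mod_cast (by omega : 1 ≤ n)
  have hbig : 2 * k * C + |L| + 1 < ε / 4 * n := by
    rw [div_lt_iff₀ (by positivity)] at hM
    have : (M : ℝ) ≤ n := by exact_mod_cast (by omega : M ≤ n)
    nlinarith
  have hsum : |∑ j ∈ Finset.range (n + 1), (F n j - L)| ≤ (n + 1) * (ε / 4) + 2 * k * C := by
    refine (Finset.abs_sum_le_sum_abs _ _).trans ?_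
    -- Only the at most `k` indices at each end of the row pay the crude bound `C`.
    have hterm : ∀ j ∈ Finset.range (n + 1), |F n j - L| ≤
        ε / 4 + ((if j < k then C else 0) + if n < j + k then C else 0) := fun j _ => by
      by_cases h1 : j < k
      · rw [if_pos h1]; split_ifs <;> linarith [hC n j]
      by_cases h2 : n < j + k
      · rw [if_neg h1, if_pos h2]; linarith [hC n j]
      · rw [if_neg h1, if_neg h2]; linarith [hk n j (by omega) (by omega)]
    refine (Finset.sum_le_sum hterm).trans ?_
    have c1 : ((Finset.range (n + 1)).filter (· < k)).card ≤ k := by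
      refine (Finset.card_le_card (t := Finset.range k) fun j hj => ?_).trans_eq (by simp)
      simpa using (Finset.mem_filter.1 hj).2
    have c2 : ((Finset.range (n + 1)).filter (n < · + k)).card ≤ k := by
      refine (Finset.card_le_card (t := Finset.Ico (n + 1 - k) (n + 1)) fun j hj => ?_).trans
        (by rw [Nat.card_Ico]; omega)
      simp only [Finset.mem_filter, Finset.mem_range] at hj
      simp only [Finset.mem_Ico]
      omega
    have c1' : (((Finset.range (n + 1)).filter (· < k)).card : ℝ) ≤ k := by exact_mod_cast c1
    have c2' : (((Finset.range (n + 1)).filter (n < · + k)).card : ℝ) ≤ k := by exact_mod_cast c2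
    rw [Finset.sum_add_distrib, Finset.sum_add_distrib, ← Finset.sum_filter, ← Finset.sum_filter]
    simp only [Finset.sum_const, nsmul_eq_mul, Finset.card_range]
    push_cast
    nlinarith
  -- There are `n + 1` terms but the divisor is `n`, which leaves one extra `L`.
  have hsplit : (n : ℝ)⁻¹ * ∑ j ∈ Finset.range (n + 1), F n j - L
      = (n : ℝ)⁻¹ * (∑ j ∈ Finset.range (n + 1), (F n j - L) + L) := by
    rw [Finset.sum_sub_distrib]
    simp only [Finset.sum_const, nsmul_eq_mul, Finset.card_range]
    push_cast
    field_simp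
    ring
  rw [Real.dist_eq, hsplit, abs_mul, abs_of_pos (inv_pos.2 hn0), inv_mul_lt_iff₀ hn0]
  have := abs_add_le (∑ j ∈ Finset.range (n + 1), (F n j - L)) L
  nlinarith

end SubsetCurrent

/-! ### Integrals against counting currents and convergence of the averages. -/

namespace SubsetCurrent

open Filter Topology MeasureTheory

variable {N : ℕ}

theorem countingMeasure_eq_sum {H : Subgroup (FreeGroup (Fin N))} (hH : H ≠ ⊥)
    (hc : Subgroup.Commensurable.commensurator H = H) :
    countingMeasure H = Measure.sum fun H' : ConjClass (Subgroup.Commensurable.commensurator H) =>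
        Measure.dirac (limitPoint H'.1 (ConjClass.ne_bot hH H')) := by
  rw [countingMeasure, dif_neg hH, show H.relIndex (Subgroup.Commensurable.commensurator H) = 1 by
    rw [hc, Subgroup.relIndex_self], one_smul]

/-- If `H` is its own commensurator and `K i` are the conjugates of `H` whose limit sets lie in `U`,
then `η_H` is on `U` the sum of the Dirac measures of the limit sets of the `K i`. -/
theorem countingMeasure_restrict {H : Subgroup (FreeGroup (Fin N))} (hH : H ≠ ⊥)
    (hc : Subgroup.Commensurable.commensurator H = H) {ι : Type*} [Fintype ι]
    {K : ι → Subgroup (FreeGroup (Fin N))} (hK : Function.Injective K) (hK0 : ∀ i, K i ≠ ⊥)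
    (hconj : ∀ i, ∃ g, K i = conjBy g H) {U : Set (SubsetSpace N)} (hU : MeasurableSet U)
    (hKU : ∀ g, limitPoint (conjBy g H) (conjBy_ne_bot hH) ∈ U → ∃ i, conjBy g H = K i) :
    (countingMeasure H).restrict U
      = (∑ i, Measure.dirac (limitPoint (K i) (hK0 i))).restrict U := by
  ext A hA
  have hAU := hA.inter hU
  rw [Measure.restrict_apply hA, Measure.restrict_apply hA, countingMeasure_eq_sum hH hc,
    Measure.sum_apply _ hAU, Measure.finsetSum_apply, ← tsum_fintype (L := .unconditional _)]
  let φ : ι → ConjClass (Subgroup.Commensurable.commensurator H) := fun i =>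
    ⟨K i, by obtain ⟨g, hg⟩ := hconj i; exact ⟨g, by rw [hc, hg]⟩⟩
  have hφ : Function.Injective φ := fun i j h => hK (congrArg Subtype.val h)
  -- A conjugate outside the range of `φ` has its limit set outside `U` and contributes nothing to
  -- `A ∩ U`.
  refine (hφ.tsum_eq (f := fun H' : ConjClass (Subgroup.Commensurable.commensurator H) =>
    Measure.dirac (limitPoint H'.1 (ConjClass.ne_bot hH H')) (A ∩ U)) fun H' hH' => ?_).symm
  rw [Function.mem_support, Measure.dirac_apply' _ hAU, Ne, Set.indicator_apply_eq_zero] at hH'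
  simp only [Pi.one_apply, one_ne_zero, imp_false, not_not] at hH'
  obtain ⟨g, hg⟩ : ∃ g, H'.1 = conjBy g H := by
    obtain ⟨g, hg⟩ := H'.2
    exact ⟨g, hg.trans (congrArg (conjBy g) hc)⟩
  have hmem : limitPoint (conjBy g H) (conjBy_ne_bot hH) ∈ U := by
    have : limitPoint (conjBy g H) (conjBy_ne_bot hH)
        = limitPoint H'.1 (ConjClass.ne_bot hH H') := Subtype.ext (congrArg limitSet hg.symm)
    rw [this]; exact hH'.2
  obtain ⟨i, hi⟩ := hKU g hmem
  exact ⟨i, Subtype.ext (hi.symm.trans hg.symm)⟩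

/-- Since `f` vanishes off `U`, the counting measure may be replaced by the finite sum of Dirac
measures agreeing with it there. -/
theorem integral_countingMeasure {H : Subgroup (FreeGroup (Fin N))} (hH : H ≠ ⊥)
    (hc : Subgroup.Commensurable.commensurator H = H) {ι : Type*} [Fintype ι]
    {K : ι → Subgroup (FreeGroup (Fin N))} (hK : Function.Injective K) (hK0 : ∀ i, K i ≠ ⊥)
    (hconj : ∀ i, ∃ g, K i = conjBy g H) {U : Set (SubsetSpace N)} (hU : MeasurableSet U)
    (hKU : ∀ g, limitPoint (conjBy g H) (conjBy_ne_bot hH) ∈ U → ∃ i, conjBy g H = K i)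
    {f : SubsetSpace N → ℝ} (hf : Continuous f) (hfU : ∀ S ∉ U, f S = 0) :
    ∫ S, f S ∂(countingMeasure H) = ∑ i, f (limitPoint (K i) (hK0 i)) := by
  rw [← setIntegral_eq_integral_of_forall_compl_eq_zero hfU,
    countingMeasure_restrict hH hc hK hK0 hconj hU hKU,
    setIntegral_eq_integral_of_forall_compl_eq_zero hfU]
  have hsm : StronglyMeasurable f := hf.stronglyMeasurable
  rw [integral_finsetSum_measure fun i _ => ?_]
  · exact Finset.sum_congr rfl fun i _ => integral_dirac' _ _ hsm
  · exact integrable_dirac' hsm (by simp)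

theorem zpowers_of_ne_bot (a : Fin N) : Subgroup.zpowers (FreeGroup.of a) ≠ ⊥ := by
  rw [Ne, Subgroup.zpowers_eq_bot]
  exact FreeGroup.of_ne_one a

theorem zpowers_rotatedWord_ne_bot (a b : Fin N) (n j : ℕ) :
    Subgroup.zpowers (FreeGroup.mk (rotatedWord a b n j)) ≠ ⊥ := by
  rw [Ne, Subgroup.zpowers_eq_bot]
  exact (isPositive_rotatedWord a b n j).mk_ne_one (rotatedWord_ne_nil a b n j)

theorem integral_countingMeasure_of (a : Fin N) {f : SubsetSpace N → ℝ} (hf : Continuous f)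
    (hfU : ∀ S ∉ throughOne N, f S = 0) :
    ∫ S, f S ∂(countingMeasure (Subgroup.zpowers (FreeGroup.of a)))
      = f (limitPoint _ (zpowers_of_ne_bot a)) := by
  have := integral_countingMeasure (zpowers_of_ne_bot a) (commensurator_zpowers_of a) (ι := Unit)
    (K := fun _ => Subgroup.zpowers (FreeGroup.of a)) (fun _ _ _ => rfl)
    (fun _ => zpowers_of_ne_bot a) (fun _ => ⟨1, (conjBy_one _).symm⟩)
    isClopen_throughOne.2.measurableSet (fun g hg => ?_) hf hfU
  · simpa using this
  · obtain ⟨ξ, hξ, η, hη, hne⟩ := hg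
    exact ⟨(), conjBy_eq_self (mem_zpowers_of_mem_limitSet hξ hη hne)⟩

/-- One summand for each vertex of the axis of `aⁿb` modulo translation. -/
theorem integral_countingMeasure_rotatedWord {a b : Fin N} (hab : a ≠ b) (n : ℕ)
    {f : SubsetSpace N → ℝ} (hf : Continuous f) (hfU : ∀ S ∉ throughOne N, f S = 0) :
    ∫ S, f S ∂(countingMeasure (Subgroup.zpowers (FreeGroup.mk (rotatedWord a b n 0))))
      = ∑ j ∈ Finset.range (n + 1), f (limitPoint _ (zpowers_rotatedWord_ne_bot a b n j)) := by
  rw [Finset.sum_range fun j => f (limitPoint _ (zpowers_rotatedWord_ne_bot a b n j))]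
  refine integral_countingMeasure (zpowers_rotatedWord_ne_bot a b n 0)
    (commensurator_zpowers_rotatedWord hab n) (ι := Fin (n + 1))
    (K := fun j => Subgroup.zpowers (FreeGroup.mk (rotatedWord a b n j))) (fun i j h => ?_)
    (fun j => zpowers_rotatedWord_ne_bot a b n j) (fun j => ?_)
    isClopen_throughOne.2.measurableSet (fun g hg => ?_) hf hfU
  · exact Fin.ext (zpowers_rotatedWord_injOn hab (Nat.lt_succ_iff.1 i.2) (Nat.lt_succ_iff.1 j.2) h)
  · exact ⟨(FreeGroup.of a ^ (j : ℕ))⁻¹, by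
      rw [conjBy_zpowers, ← mk_rotatedWord_eq_conj a b (Nat.lt_succ_iff.1 j.2)]⟩
  · obtain ⟨ξ, hξ, η, hη, hne⟩ := hg
    obtain ⟨r, hr, q, hq⟩ := exists_inv_eq_of_mem_limitSet_rotatedWord hξ hη hne
    exact ⟨⟨r, Nat.lt_succ_of_le hr⟩, conjBy_zpowers_rotatedWord hr hq⟩

theorem replicate_prefix_replicate {α : Type*} (x : α) {k l : ℕ} (h : k ≤ l) :
    List.replicate k x <+: List.replicate l x :=
  List.prefix_replicate_iff.2 ⟨by simpa using h, by simp⟩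

theorem limitPoint_mem_pairNhd {c : List (Fin N × Bool)} (hc : IsPositive c) (hc0 : c ≠ [])
    (h0 : Subgroup.zpowers (FreeGroup.mk c) ≠ ⊥) {k : ℕ} {s t : Fin N × Bool}
    (hs : ∀ m, k ≤ (List.replicate m c).flatten.length →
      List.replicate k s <+: (List.replicate m c).flatten)
    (ht : ∀ m, k ≤ (List.replicate m c).flatten.length →
      List.replicate k t <+: (List.replicate m (FreeGroup.invRev c)).flatten) :
    limitPoint _ h0 ∈ pairNhd k (constRay s) (constRay t) := by
  refine ⟨limitSet_zpowers_subset hc hs ht,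
    limitSet_zpowers_inter_nonempty (fun n => (hc.flatten_replicate n).isReduced) hc0 hs, ?_⟩
  have := limitSet_zpowers_inter_nonempty (isReduced_flatten_replicate_invRev hc)
    (invRev_ne_nil hc0) (k := k) (s := t) (fun m h => ht m (by
      simpa [FreeGroup.invRev_length] using h))
  rwa [zpowers_mk_invRev] at this

theorem limitPoint_of_mem_pairNhd (a : Fin N) (k : ℕ) :
    limitPoint _ (zpowers_of_ne_bot a) ∈ pairNhd k (constRay (a, true)) (constRay (a, false)) := by
  have hfl : ∀ (x : Fin N × Bool) (m : ℕ), (List.replicate m [x]).flatten = List.replicate m x :=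
    fun x m => by simp
  refine limitPoint_mem_pairNhd (isPositive_singleton a) (List.cons_ne_nil _ _) _
    (fun m hm => ?_) (fun m hm => ?_)
  · rw [hfl] at hm ⊢
    exact replicate_prefix_replicate _ (by simpa using hm)
  · rw [hfl] at hm
    rw [show FreeGroup.invRev [(a, true)] = [(a, false)] from rfl, hfl]
    exact replicate_prefix_replicate _ (by simpa using hm)

/-- The word `aⁿ⁻ʲ b aʲ` begins with `aᵏ` because `k ≤ n - j`, and its inverse begins with `a⁻ᵏ`
because `k ≤ j`. -/
theorem limitPoint_rotatedWord_mem_pairNhd (a b : Fin N) {n j k : ℕ} (hj : k ≤ j)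
    (hn : j + k ≤ n) : limitPoint _ (zpowers_rotatedWord_ne_bot a b n j) ∈
      pairNhd k (constRay (a, true)) (constRay (a, false)) := by
  -- For `k = 0` the length condition does not exclude the empty power, as `hm0` requires. The
  -- cylinders are then the whole boundary.
  rcases Nat.eq_zero_or_pos k with rfl | hk
  · obtain ⟨ξ, hξ⟩ := (limitPoint _ (zpowers_rotatedWord_ne_bot a b n j)).2.2.nonempty
    exact ⟨fun η _ => .inl fun i hi => absurd hi (Nat.not_lt_zero i),
      ⟨ξ, hξ, fun i hi => absurd hi (Nat.not_lt_zero i)⟩,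
      ⟨ξ, hξ, fun i hi => absurd hi (Nat.not_lt_zero i)⟩⟩
  have hpre : ∀ (d p : List (Fin N × Bool)) (m : ℕ), m ≠ 0 → p <+: d →
      p <+: (List.replicate m d).flatten := fun d p m hm hp => by
    obtain ⟨m, rfl⟩ := Nat.exists_eq_add_one_of_ne_zero hm
    rw [List.replicate_succ (n := m), List.flatten_cons]
    exact hp.trans (List.prefix_append _ _)
  have hm0 : ∀ m, k ≤ (List.replicate m (rotatedWord a b n j)).flatten.length → m ≠ 0 := by
    rintro m hm rfl
    simp at hm; omega
  refine limitPoint_mem_pairNhd (isPositive_rotatedWord a b n j) (rotatedWord_ne_nil a b n j) _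
    (fun m hm => hpre _ _ m (hm0 m hm) ?_) (fun m hm => hpre _ _ m (hm0 m hm) ?_)
  · exact (replicate_prefix_replicate _ (by omega)).trans (List.prefix_append _ _)
  · refine (replicate_prefix_replicate _ hj).trans
      ⟨(b, false) :: List.replicate (n - j) (a, false), ?_⟩
    simp [rotatedWord, FreeGroup.invRev]

/-- Convergence of the integrals of `f` against `(1/n) η_{⟨aⁿb⟩}` to that against `η_{⟨a⟩}`. -/
def AveragesConverge (a b : Fin N) (f : SubsetSpace N → ℝ) : Prop :=
  Tendsto (fun n : ℕ => (n : ℝ)⁻¹ *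
      ∫ S, f S ∂(countingMeasure (Subgroup.zpowers (FreeGroup.mk (rotatedWord a b n 0)))))
    atTop (𝓝 (∫ S, f S ∂(countingMeasure (Subgroup.zpowers (FreeGroup.of a)))))

theorem averagesConverge_of_throughOne {a b : Fin N} (hab : a ≠ b) {f : SubsetSpace N → ℝ}
    (hf : Continuous f) (hfc : HasCompactSupport f) (hfU : ∀ S ∉ throughOne N, f S = 0) :
    AveragesConverge a b f := by
  unfold AveragesConverge
  rw [integral_countingMeasure_of a hf hfU]
  simp only [integral_countingMeasure_rotatedWord hab _ hf hfU]
  obtain ⟨C, hC⟩ := hfc.exists_bound_of_continuous hf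
  refine tendsto_average_of_close (C := C + C) (fun n j => ?_) fun ε hε => ?_
  · exact (abs_sub _ _).trans (add_le_add (hC _) (hC _))
  -- Continuity of `f` at the limit set of `⟨a⟩` gives one `k` valid for all rows `n`.
  · obtain ⟨k, hk⟩ := exists_pairNhd_subset (limitPoint_of_mem_pairNhd a)
      (hf.continuousAt.preimage_mem_nhds (Metric.ball_mem_nhds _ hε))
    refine ⟨k, fun n j hj hn => ?_⟩
    exact (Metric.mem_ball.1 (hk (limitPoint_rotatedWord_mem_pairNhd a b hj hn))).le

theorem map_translate_eq {μ : Measure (SubsetSpace N)} (hμ : μ ∈ SCurr N)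
    (g : FreeGroup (Fin N)) : μ.map (translate g) = μ := by
  ext U hU
  rw [Measure.map_apply (continuous_translate g).measurable hU, hμ.1 g U hU]

theorem integral_comp_translate {μ : Measure (SubsetSpace N)} (hμ : μ ∈ SCurr N)
    (g : FreeGroup (Fin N)) (f : SubsetSpace N → ℝ) (hf : Continuous f) :
    ∫ S, f (translate g S) ∂μ = ∫ S, f S ∂μ := by
  conv_rhs => rw [← map_translate_eq hμ g]
  rw [integral_map (continuous_translate g).measurable.aemeasurable
    hf.aestronglyMeasurable]

theorem AveragesConverge.of_comp_translate {a b : Fin N} {f : SubsetSpace N → ℝ}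
    (hf : Continuous f) (g : FreeGroup (Fin N))
    (h : AveragesConverge a b fun S => f (translate g S)) : AveragesConverge a b f := by
  unfold AveragesConverge at h ⊢
  simpa only [integral_comp_translate (countingMeasure_mem (fg_zpowers _)) g f hf] using h

theorem integrable_of_mem_SCurr {μ : Measure (SubsetSpace N)} (hμ : μ ∈ SCurr N)
    {f : SubsetSpace N → ℝ} (hf : Continuous f) (hfc : HasCompactSupport f) :
    Integrable f μ := by
  have : IsFiniteMeasureOnCompacts μ := ⟨fun K hK => hμ.2 K hK⟩
  exact hf.integrable_of_hasCompactSupport hfc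

theorem AveragesConverge.add {a b : Fin N} {f f' : SubsetSpace N → ℝ}
    (hf : Continuous f) (hfc : HasCompactSupport f) (hf' : Continuous f')
    (hfc' : HasCompactSupport f') (h : AveragesConverge a b f) (h' : AveragesConverge a b f') :
    AveragesConverge a b (f + f') := by
  have key : ∀ w : FreeGroup (Fin N), ∫ S, (f + f') S ∂(countingMeasure (Subgroup.zpowers w))
      = ∫ S, f S ∂(countingMeasure (Subgroup.zpowers w))
        + ∫ S, f' S ∂(countingMeasure (Subgroup.zpowers w)) := fun w =>
    integral_add' (integrable_of_mem_SCurr (countingMeasure_mem (fg_zpowers w)) hf hfc)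
      (integrable_of_mem_SCurr (countingMeasure_mem (fg_zpowers w)) hf' hfc')
  unfold AveragesConverge at *
  simp only [key, mul_add]
  exact Filter.Tendsto.add h h'

theorem hasCompactSupport_indicator {X : Type*} [TopologicalSpace X] {f : X → ℝ}
    (hfc : HasCompactSupport f) (U : Set X) : HasCompactSupport (U.indicator f) :=
  hfc.mono (by rw [Set.support_indicator]; exact Set.inter_subset_right)

/-- Clopen sets allow a partition without bump functions: cutting `f` along one translate of
`throughOne` keeps both pieces continuous, and the remainder needs one translate fewer. -/
theorem averagesConverge_of_finset {a b : Fin N} (hab : a ≠ b) (B : Finset (FreeGroup (Fin N)))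
    {f : SubsetSpace N → ℝ} (hf : Continuous f) (hfc : HasCompactSupport f)
    (hfB : ∀ S, f S ≠ 0 → ∃ g ∈ B, translate g S ∈ throughOne N) : AveragesConverge a b f := by
  classical
  induction B using Finset.induction_on generalizing f with
  | empty =>
    have : f = 0 := funext fun S => by
      by_contra h
      simpa using hfB S h
    subst this
    simp [AveragesConverge]
  | insert g B _ ih =>
    set U : Set (SubsetSpace N) := translate g ⁻¹' throughOne N with hU
    have hUc : IsClopen U := isClopen_throughOne.preimage (continuous_translate g)
    have hf1 : Continuous (U.indicator f) := hUc.continuous_indicator hf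
    have hf2 : Continuous (Uᶜ.indicator f) := hUc.compl.continuous_indicator hf
    rw [← Set.indicator_self_add_compl U f]
    refine AveragesConverge.add hf1 (hasCompactSupport_indicator hfc U) hf2
      (hasCompactSupport_indicator hfc _) ?_ ?_
    -- Composition with `g⁻¹` moves the support from `U` into `throughOne`, and invariance of the
    -- currents preserves the integrals.
    · refine AveragesConverge.of_comp_translate hf1 g⁻¹ (averagesConverge_of_throughOne hab
        (hf1.comp (continuous_translate _))
        ((hasCompactSupport_indicator hfc U).comp_homeomorph (translateHomeo g⁻¹)) fun S hS => ?_)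
      refine Set.indicator_of_notMem (fun hmem => hS ?_) _
      rwa [hU, Set.mem_preimage, ← translate_mul, mul_inv_cancel, translate_one] at hmem
    · refine ih hf2 (hasCompactSupport_indicator hfc _) fun S hS => ?_
      have hSU : S ∈ Uᶜ := by
        by_contra h; exact hS (Set.indicator_of_notMem h _)
      rw [Set.indicator_of_mem hSU] at hS
      obtain ⟨g', hg', hgS⟩ := hfB S hS
      rcases Finset.mem_insert.1 hg' with rfl | h
      · exact absurd hgS hSU
      · exact ⟨g', h, hgS⟩

/-- The translates of `throughOne` form an open cover, of which finitely many suffice for the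
compact support. -/
theorem averagesConverge {a b : Fin N} (hab : a ≠ b) {f : SubsetSpace N → ℝ} (hf : Continuous f)
    (hfc : HasCompactSupport f) : AveragesConverge a b f := by
  obtain ⟨B, hB⟩ := hfc.isCompact.elim_finite_subcover
    (fun g : FreeGroup (Fin N) => translate g ⁻¹' throughOne N)
    (fun g => isClopen_throughOne.2.preimage (continuous_translate g))
    (fun S _ => Set.mem_iUnion.2 (exists_translate_mem_throughOne S))
  refine averagesConverge_of_finset hab B hf hfc fun S hS => ?_
  simpa using hB (subset_tsupport f hS)

open scoped CompactlySupported in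
theorem tendsto_SCurr_iff {ι : Type*} {l : Filter ι} {μ : ι → SCurr N} {ν : SCurr N} :
    Tendsto μ l (𝓝 ν) ↔ ∀ f : C_c(SubsetSpace N, ℝ),
      Tendsto (fun i => ∫ S, f S ∂(μ i : Measure (SubsetSpace N))) l
        (𝓝 (∫ S, f S ∂(ν : Measure (SubsetSpace N)))) := by
  rw [nhds_iInf, tendsto_iInf]
  refine forall_congr' fun f => ?_
  rw [nhds_induced, tendsto_comap_iff]
  rfl

theorem tendsto_smul_counting_rotatedWord {a b : Fin N} (hab : a ≠ b) :
    Tendsto (fun n : ℕ => (n : ℝ≥0)⁻¹ •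
        counting (Subgroup.zpowers (FreeGroup.mk (rotatedWord a b n 0))) (fg_zpowers _)) atTop
      (𝓝 (counting (Subgroup.zpowers (FreeGroup.of a)) (fg_zpowers _))) := by
  refine tendsto_SCurr_iff.2 fun f => ?_
  refine (averagesConverge hab f.continuous f.hasCompactSupport).congr fun n => ?_
  rw [Submodule.coe_smul, integral_smul_nnreal_measure, NNReal.smul_def]
  simp [counting]

/-! ### The intersection products and the failure of continuity. -/

theorem doubleCosetSum_rotatedWord {a b : Fin N} (hab : a ≠ b) (n j : ℕ) :
    doubleCosetSum (Subgroup.zpowers (FreeGroup.mk (rotatedWord a b n j)))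
      (Subgroup.zpowers (FreeGroup.of a)) = 0 := by
  have h : ∀ g, countingMeasure (Subgroup.zpowers (FreeGroup.mk (rotatedWord a b n j))
      ⊓ conjBy g (Subgroup.zpowers (FreeGroup.of a))) = 0 := fun g => by
    rw [countingMeasure, dif_pos (zpowers_rotatedWord_inf_conjBy hab n j g)]
  simp [doubleCosetSum, h]

/-- The chosen representative of the trivial double coset need not be `1`, but it lies in `H`. -/
theorem conjBy_out_mk_one (H : Subgroup (FreeGroup (Fin N))) :
    conjBy (DoubleCoset.mk H H 1).out H = H := by
  obtain ⟨h, k, hh, hk, heq⟩ := DoubleCoset.mk_out_eq_mul H H 1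
  exact conjBy_eq_self (by rw [heq]; exact mul_mem (mul_mem hh (one_mem H)) hk)

theorem countingMeasure_le_doubleCosetSum_self (H : Subgroup (FreeGroup (Fin N))) :
    countingMeasure H ≤ doubleCosetSum H H := by
  have := Measure.le_sum (fun q : DoubleCoset.Quotient (H : Set (FreeGroup (Fin N)))
    (H : Set (FreeGroup (Fin N))) => countingMeasure (H ⊓ conjBy q.out H)) (DoubleCoset.mk H H 1)
  rwa [conjBy_out_mk_one, inf_idem] at this

theorem countingMeasure_of_throughOne_ne_zero (a : Fin N) :
    countingMeasure (Subgroup.zpowers (FreeGroup.of a)) (throughOne N) ≠ 0 := by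
  intro h0
  have hcont : Continuous ((throughOne N).indicator (1 : SubsetSpace N → ℝ)) :=
    isClopen_throughOne.continuous_indicator continuous_one
  -- The right-hand side is `1`, while a null set would give integral `0`.
  have h1 := integral_countingMeasure_of a hcont fun S hS => Set.indicator_of_notMem hS _
  have hmem : limitPoint _ (zpowers_of_ne_bot a) ∈ throughOne N :=
    exists_mem_limitSet_zpowers_ne (isPositive_singleton a) (List.cons_ne_nil _ _)
  rw [integral_indicator_one isClopen_throughOne.2.measurableSet, Set.indicator_of_mem hmem,
    measureReal_def, h0] at h1
  simp at h1

open scoped CompactlySupported in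
theorem not_tendsto_zero_of_throughOne_ne_zero {ν : SCurr N}
    (hν : (ν : Measure (SubsetSpace N)) (throughOne N) ≠ 0) {ι : Type*} {l : Filter ι} [l.NeBot] :
    ¬ Tendsto (fun _ : ι => (0 : SCurr N)) l (𝓝 ν) := by
  intro h
  -- The indicator is continuous because the set is clopen, and compactly supported because it is
  -- compact.
  let f : C_c(SubsetSpace N, ℝ) := ⟨⟨(throughOne N).indicator 1,
      isClopen_throughOne.continuous_indicator continuous_one⟩,
    HasCompactSupport.intro' isCompact_throughOne isClopen_throughOne.1
      fun S hS => Set.indicator_of_notMem hS _⟩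
  -- Uniqueness of limits is needed only in `ℝ`, not in the space of currents.
  have h1 := tendsto_nhds_unique tendsto_const_nhds (tendsto_SCurr_iff.1 h f)
  rw [show (fun S => f S) = (throughOne N).indicator 1 from rfl, ZeroMemClass.coe_zero,
    integral_zero_measure, integral_indicator_one isClopen_throughOne.2.measurableSet,
    measureReal_def, eq_comm, ENNReal.toReal_eq_zero_iff] at h1
  -- Finiteness on compact sets excludes infinite mass, whose real value would also be `0`.
  exact h1.elim hν (ν.2.2 _ isCompact_throughOne).ne

end SubsetCurrent

open SubsetCurrent in
theorem proposition3p3 (N : ℕ) (hN : 2 ≤ N)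
    (pf : SCurr N →ₗ[ℝ≥0] SCurr N →ₗ[ℝ≥0] SCurr N)
    (hpf : ∀ (H K : Subgroup (FreeGroup (Fin N))) (hH : H.FG) (hK : K.FG),
      (pf (counting H hH) (counting K hK) : MeasureTheory.Measure (SubsetSpace N)) =
        doubleCosetSum H K) :
    ¬ Continuous (fun p : SCurr N × SCurr N => pf p.1 p.2) ∧
    ∀ (a₁ a₂ : FreeGroup (Fin N)), a₁ = FreeGroup.of ⟨0, by omega⟩ →
      a₂ = FreeGroup.of ⟨1, by omega⟩ →
      Filter.Tendsto
        (fun n : ℕ => (n : ℝ≥0)⁻¹ •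
          counting (Subgroup.zpowers (a₁ ^ n * a₂)) (fg_zpowers (a₁ ^ n * a₂)))
        Filter.atTop (nhds (counting (Subgroup.zpowers a₁) (fg_zpowers a₁))) ∧
      ¬ Filter.Tendsto
        (fun n : ℕ => pf ((n : ℝ≥0)⁻¹ •
          counting (Subgroup.zpowers (a₁ ^ n * a₂)) (fg_zpowers (a₁ ^ n * a₂)))
          (counting (Subgroup.zpowers a₁) (fg_zpowers a₁)))
        Filter.atTop (nhds (pf (counting (Subgroup.zpowers a₁) (fg_zpowers a₁))
          (counting (Subgroup.zpowers a₁) (fg_zpowers a₁)))) := by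
  set a : Fin N := ⟨0, by omega⟩
  set b : Fin N := ⟨1, by omega⟩
  have hab : a ≠ b := by simp [a, b]
  have hconv := tendsto_smul_counting_rotatedWord hab
  have hzero : ∀ n : ℕ, pf ((n : ℝ≥0)⁻¹ •
      counting (Subgroup.zpowers (FreeGroup.mk (rotatedWord a b n 0))) (fg_zpowers _))
      (counting (Subgroup.zpowers (FreeGroup.of a)) (fg_zpowers _)) = 0 := fun n => by
    have h0 : pf (counting (Subgroup.zpowers (FreeGroup.mk (rotatedWord a b n 0))) (fg_zpowers _))
        (counting (Subgroup.zpowers (FreeGroup.of a)) (fg_zpowers _)) = 0 :=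
      Subtype.ext ((hpf _ _ _ _).trans (doubleCosetSum_rotatedWord hab n 0))
    rw [map_smul, LinearMap.smul_apply, h0, smul_zero]
  have hne : ((pf (counting (Subgroup.zpowers (FreeGroup.of a)) (fg_zpowers _))
      (counting (Subgroup.zpowers (FreeGroup.of a)) (fg_zpowers _)) : SCurr N) :
      MeasureTheory.Measure (SubsetSpace N)) (throughOne N) ≠ 0 := by
    rw [hpf]
    exact fun h => countingMeasure_of_throughOne_ne_zero a (le_antisymm
      ((countingMeasure_le_doubleCosetSum_self _ _).trans_eq h) zero_le)
  have hnot : ¬ Filter.Tendsto (fun n : ℕ => pf ((n : ℝ≥0)⁻¹ •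
        counting (Subgroup.zpowers (FreeGroup.mk (rotatedWord a b n 0))) (fg_zpowers _))
        (counting (Subgroup.zpowers (FreeGroup.of a)) (fg_zpowers _))) Filter.atTop
      (nhds (pf (counting (Subgroup.zpowers (FreeGroup.of a)) (fg_zpowers _))
        (counting (Subgroup.zpowers (FreeGroup.of a)) (fg_zpowers _)))) := by
    simp only [hzero]
    exact not_tendsto_zero_of_throughOne_ne_zero hne
  refine ⟨fun hcont => hnot ?_, ?_⟩
  -- The second argument stays fixed, so continuity already fails in the first variable alone.
  · exact (hcont.tendsto (_, _)).comp (hconv.prodMk_nhds tendsto_const_nhds)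
  · rintro _ _ rfl rfl
    simp only [mk_rotatedWord_zero] at hconv hnot
    exact ⟨hconv, hnot⟩
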